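/- Let $K,L,M\ge 2$ be integers and let $\Lambda$ be the $K\times L$ square lattice with either open or periodic boundary conditions (the Cartesian product of two paths, respectively of two cycles, on $K$ and $L$ vertices, taken as a simple graph, so that the cycle on $2$ vertices is a single edge); in the periodic case assume $K+L\ge 6$. Let $N=KL$. A configuration is a map $\sigma:\Lambda\to\{0,1,\dots,M\}$ such that for all adjacent sites $v,w$ either $\sigma(v)\sigma(w)=0$ or $\sigma(v)=\sigma(w)$; let $\mathcal X$ be the set of configurations, and let the energy be $H(\sigma)=-|\{v\in\Lambda:\sigma(v)\ne 0\}|$. For $\sigma,\sigma'\in\mathcal X$ put $$d(\sigma,\sigma')=\sum_{v\in\Lambda}\mathbf 1_{\{\sigma(v)\ne\sigma'(v)\}}\bigl(1+\mathbf 1_{\{\sigma(v)\sigma'(v)\neq 0\}}\bigr).$$ For $\sigma\ne\sigma'$ let $q(\sigma,\sigma')=\frac1{MN}$ if $d(\sigma,\sigma')=1$ (that is, $\sigma'$ arises from $\sigma$ by adding or removing one particle) and $q(\sigma,\sigma')=0$ otherwise, and let $q(\sigma,\sigma)=1-\sum_{\eta\neq\sigma}q(\sigma,\eta)$. A path $\omega:\sigma\to\sigma'$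 is a finite sequence $\omega_1=\sigma,\omega_2,\dots,\omega_n=\sigma'$ in $\mathcal X$ with $q(\omega_i,\omega_{i+1})>0$ for $1\le i<n$. The communication height is $$\Phi(\sigma,\sigma')=\min_{\omega:\sigma\to\sigma'}\max_i H(\omega_i),\qquad \Phi(\sigma,A)=\min_{\eta\in A}\Phi(\sigma,\eta)\quad\text{for nonempty }A\subseteq\mathcal X.$$ Let $\mathcal X^s\subseteq\mathcal X$ be the set of global minimizers of $H$ (the stable configurations), and let $$\Gamma(\Lambda)=\begin{cases}2K&\text{periodic boundary conditions, }K=L,\\ \min\{2K,2L\}+1&\text{periodic boundary conditions, }K\ne L,\\ \min\{K,L\}+1&\text{open boundary conditions.}\end{cases}$$ Then: (i) $\Phi(\mathbf s,\mathbf s')-H(\mathbf s)=\Gamma(\Lambda)$ for all $\mathbf s,\mathbf s'\in\mathcal X^s$ with $\mathbf s\neq\mathbf s'$; (ii) $\Phi(\sigma,\mathcal X^s)-H(\sigma)<\Gamma(\Lambda)$ for every $\sigma\in\mathcal X\setminus\mathcal X^s$. -/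

import Mathlib

namespace WidomRowlinson

/-- Boundary conditions of a rectangular grid. -/
inductive Boundary where
  | periodic
  | free

/-- The `K × L` square lattice as a graph on `Fin K × Fin L` (row index, column index).
Periodic boundary conditions give the product of two cycles, open (`free`) boundary conditions
the product of two paths. -/
def lattice (K L : ℕ) : Boundary → SimpleGraph (Fin K × Fin L)
  | .periodic => (SimpleGraph.cycleGraph K).boxProd (SimpleGraph.cycleGraph L)
  | .free => (SimpleGraph.pathGraph K).boxProd (SimpleGraph.pathGraph L)

section Model

variable {V : Type*} (G : SimpleGraph V) (M : ℕ)

/-- Widom-Rowlinson configurations with `M` particle types on `G`: the value `0` is an empty site,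
the values `1, …, M` are the types, and adjacent occupied sites carry the same type. -/
def Config : Type _ :=
  {σ : V → Fin (M + 1) // ∀ v w, G.Adj v w → σ v = 0 ∨ σ w = 0 ∨ σ v = σ w}

variable {G M}

instance [Finite V] : Finite (Config G M) :=
  inferInstanceAs (Finite {σ : V → Fin (M + 1) //
    ∀ v w, G.Adj v w → σ v = 0 ∨ σ w = 0 ∨ σ v = σ w})

noncomputable instance [Finite V] : Fintype (Config G M) := Fintype.ofFinite _

noncomputable instance : DecidableEq (Config G M) := Classical.decEq _

/-- The empty configuration, all of whose sites are unoccupied. -/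
def Config.empty : Config G M := ⟨fun _ => 0, fun _ _ _ => Or.inl rfl⟩

instance : Nonempty (Config G M) := ⟨Config.empty⟩

variable [Fintype V]

/-- The energy of a configuration: minus its number of particles. -/
noncomputable def energy (σ : Config G M) : ℝ :=
  -∑ v, if σ.1 v ≠ 0 then (1 : ℝ) else 0

/-- The distance that governs single-site updates. A site where the two configurations differ
counts `1` if one of them is empty there, and `2` if they carry particles of different types. -/
def siteDist (σ η : Config G M) : ℕ :=
  ∑ v, if σ.1 v ≠ η.1 v then (if σ.1 v ≠ 0 ∧ η.1 v ≠ 0 then 2 else 1) else 0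

/-- The connectivity function between distinct configurations, with value `0` on the diagonal. -/
noncomputable def offDiagConn (σ η : Config G M) : ℝ :=
  if siteDist σ η = 1 then 1 / ((M : ℝ) * Fintype.card V) else 0

/-- The connectivity function: `1 / (M N)` for configurations at distance `1`, `0` for
configurations at larger distance, and on the diagonal what makes the rows sum to `1`. -/
noncomputable def conn (σ η : Config G M) : ℝ :=
  if σ = η then 1 - ∑ ζ ∈ Finset.univ.erase σ, offDiagConn σ ζ else offDiagConn σ η

/-- The stable configurations: the global minimizers of the energy. -/
def stable (G : SimpleGraph V) (M : ℕ) : Set (Config G M) :=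
  {σ | ∀ η : Config G M, energy σ ≤ energy η}

/-- Paths from `σ` to `η`: finite nonempty sequences `ω₀, …, ωₙ` of configurations with `ω₀ = σ`,
`ωₙ = η` and `conn ωᵢ ωᵢ₊₁ > 0` for every `i < n`. -/
def Path (σ η : Config G M) : Type _ :=
  {ω : RelSeries {p : Config G M × Config G M | 0 < conn p.1 p.2} // ω.head = σ ∧ ω.last = η}

/-- The height of a path: the maximal energy along it. -/
noncomputable def Path.height {σ η : Config G M} (ω : Path σ η) : ℝ :=
  Finset.univ.sup' Finset.univ_nonempty (fun i => energy (ω.1.toFun i))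

/-- The communication height between two configurations: the minimal height of a path between
them (attained, see `isLeast_commHeight`). -/
noncomputable def commHeight (σ η : Config G M) : ℝ :=
  ⨅ ω : Path σ η, ω.height

/-- The communication height between two sets of configurations: the minimum of the communication
heights between their elements (attained for nonempty sets, see `isLeast_setCommHeight`). -/
noncomputable def setCommHeight (A B : Set (Config G M)) : ℝ :=
  sInf {h | ∃ σ ∈ A, ∃ η ∈ B, h = commHeight σ η}

end Model

/-- The critical energy barrier of the `K × L` lattice (with periodic boundary conditions it is
meant for `K + L ≥ 6`). -/
def barrier (K L : ℕ) : Boundary → ℕ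
  | .periodic => if K = L then 2 * K else min (2 * K) (2 * L) + 1
  | .free => min K L + 1

section WellDefined

variable {V : Type*} [Fintype V] {G : SimpleGraph V} {M : ℕ}

theorem siteDist_comm (σ η : Config G M) : siteDist σ η = siteDist η σ := by
  unfold siteDist
  refine Finset.sum_congr rfl fun v _ => ?_
  simp only [ne_comm (a := σ.1 v) (b := η.1 v), and_comm]

theorem conn_pos_of_dist (hM : 1 ≤ M) {σ η : Config G M} (h : siteDist σ η = 1) :
    0 < conn σ η := by
  have hne : σ ≠ η := by
    rintro rfl
    simp [siteDist] at h
  have hV : Nonempty V := by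
    by_contra hV
    rw [not_nonempty_iff] at hV
    simp [siteDist] at h
  have : 0 < Fintype.card V := Fintype.card_pos
  have hM' : (0 : ℝ) < M := by exact_mod_cast hM
  simp only [conn, hne, if_false, offDiagConn, h, if_true]
  positivity

open Classical in
/-- Removing the particle (if any) at a site. -/
noncomputable def remove (σ : Config G M) (v : V) : Config G M :=
  ⟨Function.update σ.1 v 0, fun a b hab => by
    have := σ.2 a b hab
    by_cases ha : a = v
    · subst ha; simp
    · by_cases hb : b = v
      · subst hb; simp
      · simpa [Function.update_of_ne ha, Function.update_of_ne hb] using this⟩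

theorem dist_remove {σ : Config G M} {v : V} (hv : σ.1 v ≠ 0) : siteDist σ (remove σ v) = 1 := by
  classical
  unfold siteDist
  rw [Finset.sum_eq_single v]
  · simp [remove, hv]
  · intro b _ hb
    simp [remove, Function.update_of_ne hb]
  · simp

theorem joined_empty (σ : Config G M) :
    Relation.ReflTransGen (fun a b : Config G M => siteDist a b = 1) σ Config.empty := by
  classical
  induction hn : (Finset.univ.filter fun v => σ.1 v ≠ 0).card generalizing σ with
  | zero =>
    have : σ = Config.empty := by
      apply Subtype.ext
      funext v
      rw [Finset.card_eq_zero, Finset.filter_eq_empty_iff] at hn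
      simpa [Config.empty] using hn (Finset.mem_univ v)
    rw [this]
  | succ n ih =>
    have hpos : 0 < (Finset.univ.filter fun v => σ.1 v ≠ 0).card := by omega
    obtain ⟨v, hv⟩ := Finset.card_pos.mp hpos
    have hv0 : σ.1 v ≠ 0 := (Finset.mem_filter.mp hv).2
    refine Relation.ReflTransGen.head (dist_remove hv0) (ih (remove σ v) ?_)
    have : (Finset.univ.filter fun w => (remove σ v).1 w ≠ 0)
        = (Finset.univ.filter fun w => σ.1 w ≠ 0).erase v := by
      ext w
      rw [Finset.mem_erase, Finset.mem_filter, Finset.mem_filter]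
      by_cases hw : w = v
      · subst hw; simp [remove]
      · simp [remove, hw]
    rw [this, Finset.card_erase_of_mem hv, hn]
    rfl

/-- The connectivity function is irreducible. -/
theorem nonempty_path (hM : 1 ≤ M) (σ η : Config G M) : Nonempty (Path σ η) := by
  have h1 := joined_empty σ
  have h2 : Relation.ReflTransGen (fun a b : Config G M => siteDist a b = 1) Config.empty η := by
    refine Relation.ReflTransGen.mono (fun a b h => ?_) _ _ (joined_empty η).swap
    exact (siteDist_comm a b).trans h
  have h3 := h1.trans h2
  clear h1 h2
  induction h3 with
  | refl => exact ⟨⟨RelSeries.singleton _ σ, rfl, rfl⟩⟩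
  | @tail b c _ hbc ih =>
    obtain ⟨ω, h0, h1⟩ := ih
    refine ⟨⟨ω.snoc c ?_, ?_, ?_⟩⟩
    · show 0 < conn _ _
      rw [h1]
      exact conn_pos_of_dist hM hbc
    · rw [RelSeries.head_snoc]; exact h0
    · rw [RelSeries.last_snoc]

/-- The infimum that defines the communication height is a minimum. -/
theorem isLeast_commHeight (hM : 1 ≤ M) (σ η : Config G M) :
    IsLeast (Set.range fun ω : Path σ η => ω.height) (commHeight σ η) := by
  have hfin : (Set.range fun ω : Path σ η => ω.height).Finite := by
    refine (Set.finite_range (energy : Config G M → ℝ)).subset ?_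
    rintro _ ⟨ω, rfl⟩
    obtain ⟨i, _, hi⟩ := Finset.exists_mem_eq_sup' (Finset.univ_nonempty)
      (fun i => energy (ω.1.toFun i))
    exact ⟨_, hi.symm⟩
  have := nonempty_path hM σ η
  exact ⟨(Set.range_nonempty _).csInf_mem hfin, fun _ h => csInf_le hfin.bddBelow h⟩

/-- The infimum that defines the communication height between two nonempty sets is a minimum. -/
theorem isLeast_setCommHeight {A B : Set (Config G M)} (hA : A.Nonempty) (hB : B.Nonempty) :
    IsLeast {h | ∃ σ ∈ A, ∃ η ∈ B, h = commHeight σ η} (setCommHeight A B) := by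
  have hfin : {h | ∃ σ ∈ A, ∃ η ∈ B, h = commHeight σ η}.Finite := by
    refine (Set.finite_range fun p : Config G M × Config G M => commHeight p.1 p.2).subset ?_
    rintro _ ⟨σ, _, η, _, rfl⟩
    exact ⟨(σ, η), rfl⟩
  obtain ⟨a, ha⟩ := hA
  obtain ⟨b, hb⟩ := hB
  exact ⟨Set.Nonempty.csInf_mem ⟨_, a, ha, b, hb, rfl⟩ hfin, fun _ h => csInf_le hfin.bddBelow h⟩

theorem stable_nonempty : (stable G M).Nonempty := by
  obtain ⟨σ, hσ⟩ := Finite.exists_min (energy : Config G M → ℝ)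
  exact ⟨σ, hσ⟩

end WellDefined

end WidomRowlinson

/-!
Energies are counted in empty sites: a configuration with `E` empty sites has energy `E - KL`, the
stable configurations are the `M` constant ones, and both claims are about how many empty sites a
path has to pass through (`Reach B`: at most `B` at all times). By transposition `K ≤ L` may be
assumed.

*Lower bound.* A line of the lattice with particles of two types has at least `t` empty sites,
with `t = 2` on a cycle and `t = 1` on a path. Call a row good if it has fewer than `t` empty sites;
its particles are of one type. Let `m` be the barrier minus `2`. With at most `m` empty sites there
is a good row, and the claim is that the common type of the good rows cannot change along a path
with at most `m + 1` empty sites. Between two configurations with at most `m` empty sites such a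
path passes a configuration `g` from which both arise by adding a particle. If `g` has a good row,
this row fixes the type, unless good rows of different types are both present; then all columns but
at most two are mixed, which takes too many empty sites except on the square torus, where the rigid
structure of such configurations (two empty sites in every other row and column) shows that they
cannot be entered. If `g` has no good row, then the rows of the two added particles are of
different types and the columns again contain too many empty sites. The counts are in
`RowsOfType.step_path`, `RowsOfType.step_torus_of_lt` and `RowsOfType.step_torus_of_eq`, and
`RowsOfType.of_reach` carries the type along a path.

*Upper bounds.* A growing region is filled with type `b` behind a shield, a set that contains its
outer boundary and is kept free of other types (`Reach.sweep`). Regions are unions of one arc per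
row, between functions `p` and `q` (the arc is empty where `q < p`) that change by at most one from
row to row; then the two sites at the ends of each arc form a shield, and `p` can be lowered one step at a time (`Lip.descend`).
Constant `q` gives shields of at most `2K` sites on the torus, and a single front gives `K` on the
grid. On the square torus one site less is needed: the region `{(j, x) | |x| < |j|}`, with cyclic
distances to `0`, can be filled with shields of `2K - 1` sites because in row `0` both ends
coincide, and transposition exchanges this region with its complement, up to the two empty diagonals
between them, so that the second half of the path mirrors the first. From a configuration that is
not stable the same column sweeps work at a lower relative cost, as the type `b` and the starting
column can be chosen such that empty sites or particles of type `b` are met.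
-/

/-! ### Configurations, single-site updates and communication heights -/

namespace WidomRowlinson

section Reachability

variable {V : Type*} [Fintype V] {G : SimpleGraph V} {M : ℕ}

/-- The number of empty sites of a configuration. -/
def empties (σ : Config G M) : ℕ := (Finset.univ.filter fun v => σ.1 v = 0).card

theorem energy_eq_empties_sub_card (σ : Config G M) :
    energy σ = (empties σ : ℝ) - Fintype.card V := by
  have h := Finset.card_filter_add_card_filter_not (s := (Finset.univ : Finset V))
    (fun v => σ.1 v = 0)
  rw [Finset.card_univ] at h
  unfold energy empties
  rw [← h, Finset.sum_boole]
  push_cast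
  simp

/-- `Sub τ σ` says that `τ` arises from `σ` by removing particles. -/
def Sub (τ σ : Config G M) : Prop := ∀ v, τ.1 v = 0 ∨ τ.1 v = σ.1 v

theorem Sub.empties_le {τ σ : Config G M} (h : Sub τ σ) : empties σ ≤ empties τ := by
  refine Finset.card_le_card fun v hv => ?_
  rw [Finset.mem_filter] at hv ⊢
  rcases h v with h | h
  · exact ⟨hv.1, h⟩
  · exact ⟨hv.1, h.trans hv.2⟩

/-- Reachability by single-site updates through configurations with at most `B` empty sites. -/
def Reach (B : ℕ) : Config G M → Config G M → Prop :=
  Relation.ReflTransGen fun σ η => siteDist σ η = 1 ∧ empties σ ≤ B ∧ empties η ≤ B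

theorem Reach.symm {B : ℕ} {σ η : Config G M} (h : Reach B σ η) : Reach B η σ := by
  induction h with
  | refl => exact .refl
  | tail _ hbc ih => exact .head ⟨(siteDist_comm _ _).trans hbc.1, hbc.2.2, hbc.2.1⟩ ih

theorem Reach.trans {B : ℕ} {σ η ζ : Config G M} (h : Reach B σ η) (h' : Reach B η ζ) :
    Reach B σ ζ := Relation.ReflTransGen.trans h h'

theorem Reach.mono {B C : ℕ} (hBC : B ≤ C) {σ η : Config G M} (h : Reach B σ η) :
    Reach C σ η :=
  Relation.ReflTransGen.mono (fun _ _ h => ⟨h.1, h.2.1.trans hBC, h.2.2.trans hBC⟩) _ _ h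

theorem Reach.of_sub {B : ℕ} {σ τ : Config G M} (h : Sub τ σ) (hB : empties τ ≤ B) :
    Reach B σ τ := by
  classical
  induction hn : (Finset.univ.filter fun v => τ.1 v ≠ σ.1 v).card generalizing σ with
  | zero =>
    have : σ = τ := by
      apply Subtype.ext
      funext v
      rw [Finset.card_eq_zero, Finset.filter_eq_empty_iff] at hn
      simpa [eq_comm] using hn (Finset.mem_univ v)
    rw [this]
    exact .refl
  | succ n ih =>
    have hpos : 0 < (Finset.univ.filter fun v => τ.1 v ≠ σ.1 v).card := by omega
    obtain ⟨v, hv⟩ := Finset.card_pos.mp hpos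
    have hv' : τ.1 v ≠ σ.1 v := (Finset.mem_filter.mp hv).2
    have hτ : τ.1 v = 0 := (h v).resolve_right hv'
    have hσ : σ.1 v ≠ 0 := fun h0 => hv' (hτ.trans h0.symm)
    have hr : ∀ w, (remove σ v).1 w = if w = v then 0 else σ.1 w := by
      intro w
      by_cases hw : w = v
      · subst hw; simp [remove]
      · simp [remove, hw]
    have hs : Sub τ (remove σ v) := by
      intro w
      rw [hr]
      split_ifs with hw
      · left; rw [hw, hτ]
      · exact h w
    refine Relation.ReflTransGen.head ⟨dist_remove hσ, h.empties_le.trans hB,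
      hs.empties_le.trans hB⟩ (ih hs ?_)
    have : (Finset.univ.filter fun w => τ.1 w ≠ (remove σ v).1 w)
        = (Finset.univ.filter fun w => τ.1 w ≠ σ.1 w).erase v := by
      ext w
      rw [Finset.mem_erase, Finset.mem_filter, Finset.mem_filter, hr]
      by_cases hw : w = v
      · subst hw; simp [hτ]
      · simp [hw]
    rw [this, Finset.card_erase_of_mem hv, hn]
    rfl

/-- Two configurations with a common subconfiguration can be joined through it. -/
theorem Reach.of_common_sub {B : ℕ} {σ η τ : Config G M} (h : Sub τ σ) (h' : Sub τ η)
    (hB : empties τ ≤ B) : Reach B σ η :=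
  (Reach.of_sub h hB).trans (Reach.of_sub h' hB).symm

theorem commHeight_le_of_reach (hM : 1 ≤ M) {B : ℕ} {σ η : Config G M} (hσ : empties σ ≤ B)
    (h : Reach B σ η) : commHeight σ η ≤ (B : ℝ) - Fintype.card V := by
  have key : ∃ ω : Path σ η, ∀ x ∈ ω.1, energy x ≤ (B : ℝ) - Fintype.card V := by
    have hle : ∀ x : Config G M, empties x ≤ B → energy x ≤ (B : ℝ) - Fintype.card V := by
      intro x hx
      rw [energy_eq_empties_sub_card]
      have : (empties x : ℝ) ≤ B := by exact_mod_cast hx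
      linarith
    induction h with
    | refl =>
      refine ⟨⟨RelSeries.singleton _ σ, rfl, rfl⟩, ?_⟩
      rintro x ⟨i, rfl⟩
      exact hle _ hσ
    | @tail b c _ hbc ih =>
      obtain ⟨⟨ω, h0, h1⟩, hω⟩ := ih
      have hr : (ω.last, c) ∈ {p : Config G M × Config G M | 0 < conn p.1 p.2} := by
        show 0 < conn _ _
        rw [h1]
        exact conn_pos_of_dist hM hbc.1
      refine ⟨⟨ω.snoc c hr, ?_, ?_⟩, ?_⟩
      · rw [RelSeries.head_snoc]; exact h0
      · rw [RelSeries.last_snoc]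
      · intro x hx
        rcases (RelSeries.mem_snoc (rel := hr)).1 hx with hx | rfl
        · exact hω x hx
        · exact hle _ hbc.2.2
  obtain ⟨ω, hω⟩ := key
  refine ((isLeast_commHeight hM σ η).2 ⟨ω, rfl⟩).trans ?_
  exact Finset.sup'_le _ _ fun i _ => hω _ ⟨i, rfl⟩

theorem reach_of_commHeight_lt (hM : 1 ≤ M) {B : ℕ} {σ η : Config G M}
    (h : commHeight σ η < (B : ℝ) + 1 - Fintype.card V) : Reach B σ η := by
  obtain ⟨⟨⟨ω, h0, h1⟩, hω⟩, -⟩ := isLeast_commHeight hM σ η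
  have hB : ∀ i, empties (ω.toFun i) ≤ B := by
    intro i
    have hi : energy (ω.toFun i) ≤ commHeight σ η := by
      rw [← hω]
      exact Finset.le_sup' (fun i => energy (ω.toFun i)) (Finset.mem_univ i)
    rw [energy_eq_empties_sub_card] at hi
    have : (empties (ω.toFun i) : ℝ) < (B : ℝ) + 1 := by linarith
    exact Nat.lt_succ_iff.1 (by exact_mod_cast this)
  have hstep : ∀ i : Fin (ω.length + 1), Reach B (ω.toFun 0) (ω.toFun i) := by
    intro i
    induction i using Fin.induction with
    | zero => exact .refl
    | succ i ih =>
      refine ih.trans ?_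
      have hc : 0 < conn (ω.toFun i.castSucc) (ω.toFun i.succ) := ω.step i
      unfold conn offDiagConn at hc
      split_ifs at hc with h2 h3
      · rw [← h2]; exact .refl
      · exact .single ⟨h3, hB _, hB _⟩
      · exact absurd hc (lt_irrefl _)
  have := hstep (Fin.last _)
  rw [← h0, ← h1]
  exact this

/-- A single-site update adds or removes one particle. -/
theorem exists_site_of_siteDist_eq_one {σ η : Config G M} (h : siteDist σ η = 1) :
    ∃ v, (∀ w, w ≠ v → σ.1 w = η.1 w) ∧ (σ.1 v = 0 ∨ η.1 v = 0) := by
  classical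
  unfold siteDist at h
  obtain ⟨v, -, hne⟩ := Finset.exists_ne_zero_of_sum_ne_zero (h.trans_ne one_ne_zero)
  have hd := Finset.add_sum_erase Finset.univ
    (fun v => if σ.1 v ≠ η.1 v then (if σ.1 v ≠ 0 ∧ η.1 v ≠ 0 then 2 else 1) else 0)
    (Finset.mem_univ v)
  refine ⟨v, ?_, ?_⟩
  · have h0 : ∑ w ∈ Finset.univ.erase v,
        (if σ.1 w ≠ η.1 w then (if σ.1 w ≠ 0 ∧ η.1 w ≠ 0 then 2 else 1) else 0) = 0 := by
      have := Nat.pos_of_ne_zero hne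
      beta_reduce at hd
      omega
    rw [Finset.sum_eq_zero_iff] at h0
    intro w hw
    have := h0 w (Finset.mem_erase.2 ⟨hw, Finset.mem_univ _⟩)
    by_contra hc
    rw [if_pos hc] at this
    split_ifs at this
  · by_contra hc
    push Not at hc
    have h2 : σ.1 v ≠ η.1 v := by
      intro h2
      simp [h2] at hne
    simp only [if_pos h2, if_pos hc] at hd
    omega

/-- Transport of configurations along a graph isomorphism. -/
def Config.comap {W : Type*} {G' : SimpleGraph W} (e : G' ≃g G) (σ : Config G M) :
    Config G' M :=
  ⟨fun w => σ.1 (e w), fun _ _ h => σ.2 _ _ (e.map_adj_iff.2 h)⟩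

variable {W : Type*} [Fintype W] {G' : SimpleGraph W} (e : G' ≃g G)

theorem empties_comap (σ : Config G M) : empties (σ.comap e) = empties σ := by
  unfold empties
  refine Finset.card_bij (fun w _ => e w) ?_ (fun _ _ _ _ h => e.injective h) ?_
  · intro w hw
    exact Finset.mem_filter.2 ⟨Finset.mem_univ _, (Finset.mem_filter.1 hw).2⟩
  · intro v hv
    refine ⟨e.symm v, Finset.mem_filter.2 ⟨Finset.mem_univ _, ?_⟩, e.apply_symm_apply v⟩
    show σ.1 (e (e.symm v)) = 0
    rw [e.apply_symm_apply]
    exact (Finset.mem_filter.1 hv).2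

theorem siteDist_comap (σ η : Config G M) :
    siteDist (σ.comap e) (η.comap e) = siteDist σ η :=
  Equiv.sum_comp e.toEquiv fun v =>
    if σ.1 v ≠ η.1 v then (if σ.1 v ≠ 0 ∧ η.1 v ≠ 0 then 2 else 1) else 0

theorem Reach.comap {B : ℕ} {σ η : Config G M} (h : Reach B σ η) :
    Reach B (σ.comap e) (η.comap e) := by
  induction h with
  | refl => exact .refl
  | tail _ hbc ih =>
    refine .tail ih ?_
    rwa [siteDist_comap, empties_comap, empties_comap]

end Reachability

end WidomRowlinson

/-! ### Lines of the lattice and stable configurations -/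

namespace WidomRowlinson

section Lines

/-- Adjacency in the cycle on `n` vertices, in terms of representatives. -/
theorem cycleGraph_adj_iff_val {n : ℕ} (hn : 2 ≤ n) (x y : Fin n) :
    (SimpleGraph.cycleGraph n).Adj x y ↔
      (y.val = x.val + 1 ∨ x.val = y.val + 1 ∨ (x.val = 0 ∧ y.val + 1 = n) ∨
        (y.val = 0 ∧ x.val + 1 = n)) := by
  obtain ⟨m, rfl⟩ := Nat.exists_eq_add_of_le' hn
  rw [SimpleGraph.cycleGraph_adj]
  have key : ∀ a b : Fin (m + 2), a - b = 1 ↔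
      (a.val = b.val + 1 ∨ (a.val = 0 ∧ b.val + 1 = m + 2)) := by
    intro a b
    rw [sub_eq_iff_eq_add, Fin.ext_iff, Fin.val_add, Fin.val_one]
    have ha := a.isLt
    have hb := b.isLt
    by_cases h : b.val + 1 = m + 2
    · rw [show 1 + b.val = m + 2 by omega, Nat.mod_self]; omega
    · rw [Nat.mod_eq_of_lt (by omega)]; omega
  rw [key, key]
  omega

variable {C : Type*} [Zero C] [DecidableEq C]

theorem exists_zero_between {n : ℕ} {g : Fin n → C}
    (hg : ∀ x y : Fin n, x.val + 1 = y.val → g x = 0 ∨ g y = 0 ∨ g x = g y)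
    {x y : Fin n} (hxy : x < y) (hx : g x ≠ 0) (hy : g y ≠ 0) (hne : g x ≠ g y) :
    ∃ z, x < z ∧ z < y ∧ g z = 0 := by
  by_contra hc
  push Not at hc
  have key : ∀ k : ℕ, ∀ h : x.val + k < n, x.val + k ≤ y.val → g ⟨x.val + k, h⟩ = g x := by
    intro k
    induction k with
    | zero => intro _ _; rfl
    | succ k ih =>
      intro h hk
      have h1 := ih (by omega) (by omega)
      rcases hg ⟨x.val + k, by omega⟩ ⟨x.val + (k + 1), h⟩ (by simp; omega) with h2 | h2 | h2
      · exact absurd (h1.symm.trans h2) hx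
      · rcases Nat.lt_or_ge (x.val + (k + 1)) y.val with h3 | h3
        · exact absurd h2 (hc _ (Fin.lt_def.2 (by simp)) (Fin.lt_def.2 h3))
        · exact absurd ((congrArg g (Fin.ext (by simp; omega))).trans h2) hy
      · rw [← h2, h1]
  have := key (y.val - x.val) (by omega) (by omega)
  exact hne (this.symm.trans (congrArg g (Fin.ext (by simp; omega))))

theorem path_mixed {n : ℕ} {g : Fin n → C}
    (hg : ∀ x y, (SimpleGraph.pathGraph n).Adj x y → g x = 0 ∨ g y = 0 ∨ g x = g y)
    {x y : Fin n} (hx : g x ≠ 0) (hy : g y ≠ 0) (hne : g x ≠ g y) :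
    1 ≤ (Finset.univ.filter fun z => g z = 0).card := by
  have hg' : ∀ x y : Fin n, x.val + 1 = y.val → g x = 0 ∨ g y = 0 ∨ g x = g y := fun x y h =>
    hg x y (SimpleGraph.pathGraph_adj.2 (Or.inl h))
  rw [Nat.succ_le_iff, Finset.card_pos]
  rcases lt_trichotomy x y with h | h | h
  · obtain ⟨z, -, -, hz⟩ := exists_zero_between hg' h hx hy hne
    exact ⟨z, by simpa using hz⟩
  · exact absurd (congrArg g h) hne
  · obtain ⟨z, -, -, hz⟩ := exists_zero_between hg' h hy hx hne.symm
    exact ⟨z, by simpa using hz⟩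

theorem cycle_mixed {n : ℕ} (hn : 2 ≤ n) {g : Fin n → C}
    (hg : ∀ x y, (SimpleGraph.cycleGraph n).Adj x y → g x = 0 ∨ g y = 0 ∨ g x = g y)
    {x y : Fin n} (hx : g x ≠ 0) (hy : g y ≠ 0) (hne : g x ≠ g y) :
    2 ≤ (Finset.univ.filter fun z => g z = 0).card := by
  wlog hxy : x < y generalizing x y
  · exact this hy hx hne.symm (lt_of_le_of_ne (not_lt.1 hxy) fun h => hne (congrArg g h.symm))
  have hg' : ∀ x y : Fin n, x.val + 1 = y.val → g x = 0 ∨ g y = 0 ∨ g x = g y := fun x y h =>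
    hg x y ((cycleGraph_adj_iff_val hn x y).2 (Or.inl h.symm))
  obtain ⟨z, hz1, hz2, hz⟩ := exists_zero_between hg' hxy hx hy hne
  -- the complementary arc runs from `y` to the last vertex, and on from vertex `0` to `x`
  have hout : ∃ w, (w < x ∨ y < w) ∧ g w = 0 := by
    by_contra hc
    push Not at hc
    have h0 : g ⟨0, by omega⟩ = g x := by
      rcases Nat.eq_zero_or_pos x.val with h | h
      · exact congrArg g (Fin.ext h.symm)
      · by_contra hne0
        obtain ⟨w, -, hw, hw0⟩ := exists_zero_between hg' (x := ⟨0, by omega⟩) (y := x)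
          (Fin.lt_def.2 h) (hc _ (Or.inl (Fin.lt_def.2 h))) hx hne0
        exact hc w (Or.inl hw) hw0
    have h1 : g ⟨n - 1, by omega⟩ = g y := by
      rcases Nat.lt_or_ge y.val (n - 1) with h | h
      · by_contra hne0
        obtain ⟨w, hw, -, hw0⟩ := exists_zero_between hg' (x := y) (y := ⟨n - 1, by omega⟩)
          (Fin.lt_def.2 h) hy (hc _ (Or.inr (Fin.lt_def.2 h))) (Ne.symm hne0)
        exact hc w (Or.inr hw) hw0
      · exact congrArg g (Fin.ext (by simp; omega))
    have := hg ⟨0, by omega⟩ ⟨n - 1, by omega⟩ ((cycleGraph_adj_iff_val hn _ _).2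
      (by simp; omega))
    rw [h0, h1] at this
    tauto
  obtain ⟨w, hw, hw0⟩ := hout
  have hne' : z ≠ w := by
    rintro rfl
    rcases hw with h | h
    · exact absurd hz1 (not_lt.2 h.le)
    · exact absurd hz2 (not_lt.2 h.le)
  rw [← Finset.card_pair hne']
  refine Finset.card_le_card fun a ha => ?_
  rw [Finset.mem_insert, Finset.mem_singleton] at ha
  rcases ha with rfl | rfl <;> simpa

end Lines

section Rectangles

variable {α β C : Type*} [Fintype α] [Fintype β] [Zero C] [DecidableEq C]

/-- The number of empty sites in a row. -/
def rowZeros (f : α × β → C) (j : α) : ℕ := (Finset.univ.filter fun x => f (j, x) = 0).card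

/-- The number of empty sites in a column. -/
def colZeros (f : α × β → C) (x : β) : ℕ := (Finset.univ.filter fun j => f (j, x) = 0).card

theorem sum_rowZeros (f : α × β → C) :
    ∑ j, rowZeros f j = (Finset.univ.filter fun v => f v = 0).card := by
  simp only [rowZeros, Finset.card_filter]
  exact (Fintype.sum_prod_type fun v => if f v = 0 then 1 else 0).symm

theorem sum_colZeros (f : α × β → C) :
    ∑ x, colZeros f x = (Finset.univ.filter fun v => f v = 0).card := by
  simp only [colZeros, Finset.card_filter]
  exact (Fintype.sum_prod_type_right fun v => if f v = 0 then 1 else 0).symm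

/-- A row or column with particles of two different types has at least `t` empty sites. -/
def Separating (t : ℕ) (f : α × β → C) : Prop :=
  (∀ j x y, f (j, x) ≠ 0 → f (j, y) ≠ 0 → f (j, x) ≠ f (j, y) → t ≤ rowZeros f j) ∧
  (∀ x i j, f (i, x) ≠ 0 → f (j, x) ≠ 0 → f (i, x) ≠ f (j, x) → t ≤ colZeros f x)

end Rectangles

section Lattice

variable {K L M : ℕ}

/-- The line graph on `n` vertices that underlies the lattice with given boundary conditions. -/
def lineGraph (n : ℕ) : Boundary → SimpleGraph (Fin n)
  | .periodic => SimpleGraph.cycleGraph n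
  | .free => SimpleGraph.pathGraph n

theorem lattice_eq_boxProd (K L : ℕ) (bc : Boundary) :
    lattice K L bc = (lineGraph K bc).boxProd (lineGraph L bc) := by
  cases bc <;> rfl

theorem lattice_adj {bc : Boundary} {v w : Fin K × Fin L} :
    (lattice K L bc).Adj v w ↔
      ((lineGraph K bc).Adj v.1 w.1 ∧ v.2 = w.2) ∨ ((lineGraph L bc).Adj v.2 w.2 ∧ v.1 = w.1) := by
  rw [lattice_eq_boxProd, SimpleGraph.boxProd_adj]

/-- The number of empty sites that separate two types on a line: two on a cycle, one on a path. -/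
def lineSep : Boundary → ℕ
  | .periodic => 2
  | .free => 1

theorem line_mixed {n : ℕ} (hn : 2 ≤ n) {bc : Boundary} {g : Fin n → Fin (M + 1)}
    (hg : ∀ x y, (lineGraph n bc).Adj x y → g x = 0 ∨ g y = 0 ∨ g x = g y)
    {x y : Fin n} (hx : g x ≠ 0) (hy : g y ≠ 0) (hne : g x ≠ g y) :
    lineSep bc ≤ (Finset.univ.filter fun z => g z = 0).card := by
  cases bc with
  | periodic => exact cycle_mixed hn hg hx hy hne
  | free => exact path_mixed hg hx hy hne

theorem Config.separating (hK : 2 ≤ K) (hL : 2 ≤ L) {bc : Boundary}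
    (σ : Config (lattice K L bc) M) : Separating (lineSep bc) σ.1 :=
  ⟨fun j _ _ => line_mixed hL (g := fun x => σ.1 (j, x)) fun _ _ h =>
      σ.2 _ _ (lattice_adj.2 (Or.inr ⟨h, rfl⟩)),
    fun x _ _ => line_mixed hK (g := fun j => σ.1 (j, x)) fun _ _ h =>
      σ.2 _ _ (lattice_adj.2 (Or.inl ⟨h, rfl⟩))⟩

/-- The configuration with all sites occupied by particles of type `a`. -/
def Config.const {V : Type*} (G : SimpleGraph V) (a : Fin (M + 1)) : Config G M :=
  ⟨fun _ => a, fun _ _ _ => Or.inr (Or.inr rfl)⟩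

theorem empties_const {V : Type*} [Fintype V] (G : SimpleGraph V) {a : Fin (M + 1)}
    (ha : a ≠ 0) : empties (Config.const G a) = 0 :=
  Finset.card_eq_zero.2 (Finset.filter_eq_empty_iff.2 fun _ _ => ha)

theorem eq_const_of_empties_eq_zero (hK : 2 ≤ K) (hL : 2 ≤ L) {bc : Boundary}
    {σ : Config (lattice K L bc) M} (h : empties σ = 0) :
    ∃ a, a ≠ 0 ∧ σ = Config.const _ a := by
  have hsep : 1 ≤ lineSep bc := by cases bc <;> simp [lineSep]
  have hz : ∀ v, σ.1 v ≠ 0 := fun v =>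
    (Finset.filter_eq_empty_iff.1 (Finset.card_eq_zero.1 h)) (Finset.mem_univ v)
  have hr : ∀ j, rowZeros σ.1 j = 0 := fun j =>
    Finset.card_eq_zero.2 (Finset.filter_eq_empty_iff.2 fun _ _ => hz _)
  have hc : ∀ x, colZeros σ.1 x = 0 := fun x =>
    Finset.card_eq_zero.2 (Finset.filter_eq_empty_iff.2 fun _ _ => hz _)
  have hs := σ.separating hK hL
  refine ⟨σ.1 (⟨0, by omega⟩, ⟨0, by omega⟩), hz _, Subtype.ext (funext fun v => ?_)⟩
  have h1 : σ.1 v = σ.1 (v.1, ⟨0, by omega⟩) := by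
    by_contra hne
    have := hs.1 v.1 v.2 _ (hz _) (hz _) hne
    have := hr v.1
    omega
  have h2 : σ.1 (v.1, ⟨0, by omega⟩) = σ.1 (⟨0, by omega⟩, ⟨0, by omega⟩) := by
    by_contra hne
    have := hs.2 _ v.1 _ (hz _) (hz _) hne
    have := hc ⟨0, by omega⟩
    omega
  exact h1.trans h2

theorem mem_stable_iff {V : Type*} [Fintype V] {G : SimpleGraph V} (hM : 1 ≤ M)
    {σ : Config G M} : σ ∈ stable G M ↔ empties σ = 0 := by
  constructor
  · intro h
    have h1 : (1 : Fin (M + 1)) ≠ 0 := by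
      obtain ⟨m, rfl⟩ := Nat.exists_eq_add_of_le' hM
      exact one_ne_zero
    have := h (Config.const G 1)
    rw [energy_eq_empties_sub_card, energy_eq_empties_sub_card, empties_const G h1] at this
    have h0 : (empties σ : ℝ) ≤ 0 := by
      push_cast at this
      linarith
    exact Nat.le_zero.1 (by exact_mod_cast h0)
  · intro h η
    rw [energy_eq_empties_sub_card, energy_eq_empties_sub_card, h]
    have : (0 : ℝ) ≤ empties η := Nat.cast_nonneg _
    push_cast
    linarith

/-- Exchanging rows and columns. -/
def latticeSwap (K L : ℕ) (bc : Boundary) : lattice K L bc ≃g lattice L K bc where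
  toEquiv := Equiv.prodComm _ _
  map_rel_iff' := by
    intro v w
    rw [lattice_adj, lattice_adj]
    exact or_comm

end Lattice

end WidomRowlinson

/-! ### Row types on rectangles -/

namespace WidomRowlinson

set_option linter.unusedSectionVars false

section Rectangles

variable {α β C : Type*} [Fintype α] [Fintype β] [Zero C] [DecidableEq C]

/-- All particles in rows with fewer than `t` empty sites are of type `c`. -/
def RowsOfType (t : ℕ) (f : α × β → C) (c : C) : Prop :=
  ∀ j x, rowZeros f j < t → f (j, x) ≠ 0 → f (j, x) = c

/-- `f` arises from `g` by adding at most one particle, at the site `u`. -/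
def AddAt (g f : α × β → C) (u : α × β) : Prop :=
  (∀ w, w ≠ u → g w = f w) ∧ (g u = 0 ∨ g u = f u)

variable {f g h : α × β → C} {u v : α × β}

theorem AddAt.eq_of_ne_zero (H : AddAt g f u) {w : α × β} (hw : g w ≠ 0) : f w = g w := by
  by_cases hu : w = u
  · subst hu; exact (H.2.resolve_left hw).symm
  · exact (H.1 w hu).symm

theorem AddAt.eq_of_apply_ne_zero (H : AddAt g f u) (hu : g u ≠ 0) : g = f := by
  funext w
  by_cases hw : w = u
  · subst hw; exact H.2.resolve_left hu
  · exact H.1 w hw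

theorem AddAt.rowZeros_le (H : AddAt g f u) (j : α) : rowZeros f j ≤ rowZeros g j := by
  refine Finset.card_le_card fun x hx => ?_
  rw [Finset.mem_filter] at hx ⊢
  refine ⟨hx.1, ?_⟩
  by_contra hc
  exact hc ((H.eq_of_ne_zero hc).symm.trans hx.2)

theorem AddAt.rowZeros_eq (H : AddAt g f u) {j : α} (hj : j ≠ u.1) :
    rowZeros f j = rowZeros g j := by
  unfold rowZeros
  congr 1
  ext x
  rw [Finset.mem_filter, Finset.mem_filter, H.1 (j, x) fun h => hj (congrArg Prod.fst h)]

theorem AddAt.rowZeros_add_one (H : AddAt g f u) (hg : g u = 0) (hf : f u ≠ 0) :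
    rowZeros g u.1 = rowZeros f u.1 + 1 := by
  classical
  unfold rowZeros
  rw [← Finset.card_insert_of_notMem (a := u.2)]
  · congr 1
    ext x
    rw [Finset.mem_filter, Finset.mem_insert, Finset.mem_filter]
    by_cases hx : x = u.2
    · subst hx; simpa using hg
    · rw [H.1 (u.1, x) fun h => hx (congrArg Prod.snd h)]
      simp [hx]
  · simpa using hf

theorem AddAt.colZeros_add_one (H : AddAt g f u) (hg : g u = 0) (hf : f u ≠ 0) :
    colZeros g u.2 = colZeros f u.2 + 1 := by
  classical
  unfold colZeros
  rw [← Finset.card_insert_of_notMem (a := u.1)]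
  · congr 1
    ext x
    rw [Finset.mem_filter, Finset.mem_insert, Finset.mem_filter]
    by_cases hx : x = u.1
    · subst hx; simpa using hg
    · rw [H.1 (x, u.2) fun h => hx (congrArg Prod.fst h)]
      simp [hx]
  · simpa using hf

theorem AddAt.colZeros_le_add_one (H : AddAt g f u) (x : β) :
    colZeros g x ≤ colZeros f x + 1 := by
  classical
  refine (Finset.card_le_card (t := insert u.1 (Finset.univ.filter fun j => f (j, x) = 0))
    fun j hj => ?_).trans (Finset.card_insert_le _ _)
  rw [Finset.mem_insert, Finset.mem_filter]
  by_cases hju : j = u.1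
  · exact Or.inl hju
  · refine Or.inr ⟨Finset.mem_univ _, ?_⟩
    rw [← H.1 (j, x) fun h => hju (congrArg Prod.fst h)]
    exact (Finset.mem_filter.1 hj).2

theorem AddAt.card_zeros_le (H : AddAt g f u) :
    (Finset.univ.filter fun w => g w = 0).card ≤
      (Finset.univ.filter fun w => f w = 0).card + 1 := by
  classical
  refine (Finset.card_le_card (t := insert u (Finset.univ.filter fun w => f w = 0))
    fun w hw => ?_).trans (Finset.card_insert_le _ _)
  rw [Finset.mem_insert, Finset.mem_filter]
  by_cases hwu : w = u
  · exact Or.inl hwu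
  · refine Or.inr ⟨Finset.mem_univ _, ?_⟩
    rw [← H.1 w hwu]
    exact (Finset.mem_filter.1 hw).2

theorem one_le_colZeros {j : α} {x : β} (hf : f (j, x) = 0) : 1 ≤ colZeros f x :=
  Finset.card_pos.2 ⟨j, by simpa using hf⟩

theorem two_le_colZeros {i j : α} {x : β} (hij : i ≠ j) (hi : f (i, x) = 0)
    (hj : f (j, x) = 0) : 2 ≤ colZeros f x := by
  classical
  unfold colZeros
  rw [← Finset.card_pair hij]
  refine Finset.card_le_card fun a ha => ?_
  rw [Finset.mem_insert, Finset.mem_singleton] at ha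
  rcases ha with rfl | rfl <;> simpa

theorem ne_zero_of_rowZeros_lt_one {j : α} (hj : rowZeros f j < 1) (x : β) : f (j, x) ≠ 0 :=
  Finset.filter_eq_empty_iff.1 (Finset.card_eq_zero.1 (Nat.lt_one_iff.1 hj)) (Finset.mem_univ x)

theorem exists_unique_zero_of_rowZeros_lt_two [Nonempty β] {j : α} (hj : rowZeros f j < 2) :
    ∃ e, ∀ x, x ≠ e → f (j, x) ≠ 0 := by
  rcases Finset.eq_empty_or_nonempty (Finset.univ.filter fun x => f (j, x) = 0) with h0 | ⟨e, he⟩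
  · exact ⟨Classical.arbitrary β, fun x _ => Finset.filter_eq_empty_iff.1 h0 (Finset.mem_univ x)⟩
  · refine ⟨e, fun x hx h0 => hx ?_⟩
    exact Finset.card_le_one.1 (Nat.lt_succ_iff.1 hj) x (by simpa using h0) e he

theorem Separating.row_eq {t : ℕ} (hs : Separating t f) {j : α} (hj : rowZeros f j < t) {x y : β}
    (hx : f (j, x) ≠ 0) (hy : f (j, y) ≠ 0) : f (j, x) = f (j, y) := by
  by_contra hne
  exact absurd (hs.1 j x y hx hy hne) (not_le.2 hj)

theorem Separating.col_eq {t : ℕ} (hs : Separating t f) {x : β} (hx : colZeros f x < t) {i j : α}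
    (hi : f (i, x) ≠ 0) (hj : f (j, x) ≠ 0) : f (i, x) = f (j, x) := by
  by_contra hne
  exact absurd (hs.2 x i j hi hj hne) (not_le.2 hx)

theorem sum_ite_eq_one {ι : Type*} [Fintype ι] [DecidableEq ι] (e : ι) :
    ∑ z : ι, (if z = e then 1 else 0) = 1 := by simp

/-- If two full rows carry different types, every column has an empty site. -/
theorem card_le_zeros_of_full_rows (hs : Separating 1 f) {r r' : α} {x y : β}
    (hr : rowZeros f r < 1) (hr' : rowZeros f r' < 1) (hne : f (r, x) ≠ f (r', y)) :
    Fintype.card β ≤ (Finset.univ.filter fun w => f w = 0).card := by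
  have hz := ne_zero_of_rowZeros_lt_one hr
  have hz' := ne_zero_of_rowZeros_lt_one hr'
  rw [← sum_colZeros, ← Finset.card_univ, Finset.card_eq_sum_ones]
  refine Finset.sum_le_sum fun z _ => hs.2 z r r' (hz z) (hz' z) ?_
  rwa [hs.row_eq hr (hz z) (hz x), hs.row_eq hr' (hz' z) (hz' y)]

/-- On a grid of paths with at most `K - 1` empty sites before and after the removal of one
particle and the addition of another, the type of the full rows does not change. -/
theorem RowsOfType.step_path {c : C} (hα : 2 ≤ Fintype.card α)
    (hαβ : Fintype.card α ≤ Fintype.card β) (hsg : Separating 1 g) (hsf : Separating 1 f)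
    (hsh : Separating 1 h) (hf : (Finset.univ.filter fun w => f w = 0).card + 1 ≤ Fintype.card α)
    (hh : (Finset.univ.filter fun w => h w = 0).card + 1 ≤ Fintype.card α)
    (Hf : AddAt g f u) (Hh : AddAt g h v) (hc : RowsOfType 1 f c) : RowsOfType 1 h c := by
  classical
  intro r' y hr' hy
  by_contra hne
  have hg := Hf.card_zeros_le
  obtain ⟨x₀, x₁, hx⟩ := Fintype.one_lt_card_iff.1 (show 1 < Fintype.card β by omega)
  by_cases hgood : ∃ r, rowZeros g r < 1
  · obtain ⟨r, hr⟩ := hgood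
    have h0 := ne_zero_of_rowZeros_lt_one hr x₀
    have h1 : g (r, x₀) = c := by
      rw [← Hf.eq_of_ne_zero h0]
      exact hc r x₀ ((Hf.rowZeros_le r).trans_lt hr) (by rwa [Hf.eq_of_ne_zero h0])
    have := card_le_zeros_of_full_rows (x := x₀) (y := y) hsh ((Hh.rowZeros_le r).trans_lt hr) hr'
      (by rw [Hh.eq_of_ne_zero h0, h1]; exact Ne.symm hne)
    omega
  push Not at hgood
  have hgu : g u = 0 := by
    by_contra h0
    have := Hf.eq_of_apply_ne_zero h0
    subst this
    have := Finset.sum_le_sum fun j (_ : j ∈ Finset.univ) => hgood j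
    rw [sum_rowZeros, ← Finset.card_eq_sum_ones, Finset.card_univ] at this
    omega
  have hgv : g v = 0 := by
    by_contra h0
    have := Hh.eq_of_apply_ne_zero h0
    subst this
    have := hgood r'
    omega
  obtain ⟨r, hr⟩ : ∃ r, rowZeros f r < 1 := by
    by_contra hcon
    push Not at hcon
    have := Finset.sum_le_sum fun j (_ : j ∈ Finset.univ) => hcon j
    rw [sum_rowZeros, ← Finset.card_eq_sum_ones, Finset.card_univ] at this
    omega
  have hru : r = u.1 := by
    by_contra h0
    have := Hf.rowZeros_eq h0
    have := hgood r
    omega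
  have hrv : r' = v.1 := by
    by_contra h0
    have := Hh.rowZeros_eq h0
    have := hgood r'
    omega
  have hfr : ∀ x, f (r, x) = c := fun x => hc r x hr (ne_zero_of_rowZeros_lt_one hr x)
  have hhr : ∀ x, h (r', x) ≠ c := fun x hx => hne
    ((hsh.row_eq hr' hy (ne_zero_of_rowZeros_lt_one hr' x)).trans hx)
  have hf0 : ∀ x, f (r, x) ≠ 0 := ne_zero_of_rowZeros_lt_one hr
  have hh0 : ∀ x, h (r', x) ≠ 0 := ne_zero_of_rowZeros_lt_one hr'
  have hgr : ∀ x, x ≠ u.2 → g (r, x) = f (r, x) := fun x hx =>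
    Hf.1 _ fun h => hx (congrArg Prod.snd h)
  have hgr' : ∀ x, x ≠ v.2 → g (r', x) = h (r', x) := fun x hx =>
    Hh.1 _ fun h => hx (congrArg Prod.snd h)
  have hrr : r ≠ r' := by
    rintro rfl
    have huv : u.2 = v.2 := by
      by_contra h0
      have h1 := hgr v.2 (Ne.symm h0)
      rw [show (r, v.2) = v from Prod.ext hrv rfl, hgv] at h1
      exact hf0 v.2 (by rw [show (r, v.2) = v from Prod.ext hrv rfl]; exact h1.symm)
    obtain ⟨z, hz⟩ : ∃ z, z ≠ u.2 := by
      by_cases h0 : x₀ = u.2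
      · exact ⟨x₁, fun h1 => hx (h0.trans h1.symm)⟩
      · exact ⟨x₀, h0⟩
    exact hhr z ((hgr' z (huv ▸ hz)).symm.trans ((hgr z hz).trans (hfr z)))
  -- every column has an empty site in `g`, and the column of `u` has two
  have key : ∀ z, 1 + (if z = u.2 then 1 else 0) ≤ colZeros g z := by
    intro z
    by_cases hzu : z = u.2
    · rw [if_pos hzu]
      by_cases hzv : z = v.2
      · refine two_le_colZeros hrr ?_ ?_
        · rw [hru, hzu]; exact hgu
        · rw [hrv, hzv]; exact hgv
      · have h1 : f (r', z) = h (r', z) := by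
          rw [← hgr' z hzv]
          exact Hf.eq_of_ne_zero (by rw [hgr' z hzv]; exact hh0 z)
        have h2 := hsf.2 z r r' (hf0 z) (by rw [h1]; exact hh0 z)
          (by rw [hfr, h1]; exact (hhr z).symm)
        have h3 := Hf.colZeros_add_one hgu (by
          have := hf0 u.2
          rwa [hru] at this)
        rw [hzu] at h2 ⊢
        omega
    · rw [if_neg hzu]
      by_cases hzv : z = v.2
      · refine one_le_colZeros (j := r') ?_
        rw [hrv, hzv]; exact hgv
      · refine hsg.2 z r r' ?_ ?_ ?_
        · rw [hgr z hzu]; exact hf0 z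
        · rw [hgr' z hzv]; exact hh0 z
        · rw [hgr z hzu, hgr' z hzv, hfr]; exact (hhr z).symm
  have := Finset.sum_le_sum fun z (_ : z ∈ Finset.univ) => key z
  rw [sum_colZeros, Finset.sum_add_distrib, sum_ite_eq_one, ← Finset.card_eq_sum_ones,
    Finset.card_univ] at this
  omega

/-- If two rows with at most one empty site carry different types, then every column has two
empty sites, up to one site in each of the two rows. -/
theorem two_le_colZeros_add (hs : Separating 2 f) [DecidableEq β] {r r' : α} {e e' x y : β}
    (hr : rowZeros f r < 2) (hr' : rowZeros f r' < 2) (he : ∀ z, z ≠ e → f (r, z) ≠ 0)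
    (he' : ∀ z, z ≠ e' → f (r', z) ≠ 0) (hx : f (r, x) ≠ 0) (hy : f (r', y) ≠ 0)
    (hne : f (r, x) ≠ f (r', y)) (z : β) :
    2 ≤ colZeros f z + (if z = e then 1 else 0) + (if z = e' then 1 else 0) := by
  have hmix : f (r, z) ≠ 0 → f (r', z) ≠ 0 → 2 ≤ colZeros f z := fun h1 h2 =>
    hs.2 z r r' h1 h2 (by rwa [hs.row_eq hr h1 hx, hs.row_eq hr' h2 hy])
  by_cases h1 : f (r, z) = 0
  · have hze : z = e := by
      by_contra h0
      exact he z h0 h1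
    have := one_le_colZeros h1
    rw [if_pos hze]
    omega
  · by_cases h2 : f (r', z) = 0
    · have hze : z = e' := by
        by_contra h0
        exact he' z h0 h2
      have := one_le_colZeros h2
      rw [if_pos hze]
      omega
    · have := hmix h1 h2
      omega

theorem two_mul_card_le_zeros_of_rows [Nonempty β] (hs : Separating 2 f) {r r' : α} {x y : β}
    (hr : rowZeros f r < 2) (hr' : rowZeros f r' < 2) (hx : f (r, x) ≠ 0) (hy : f (r', y) ≠ 0)
    (hne : f (r, x) ≠ f (r', y)) :
    2 * Fintype.card β ≤ (Finset.univ.filter fun w => f w = 0).card + 2 := by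
  classical
  obtain ⟨e, he⟩ := exists_unique_zero_of_rowZeros_lt_two hr
  obtain ⟨e', he'⟩ := exists_unique_zero_of_rowZeros_lt_two hr'
  have := Finset.sum_le_sum fun z (_ : z ∈ Finset.univ) =>
    two_le_colZeros_add hs hr hr' he he' hx hy hne z
  rw [Finset.sum_add_distrib, Finset.sum_add_distrib, sum_ite_eq_one, sum_ite_eq_one,
    sum_colZeros, Finset.sum_const, Finset.card_univ, smul_eq_mul] at this
  omega

theorem exists_rowZeros_lt (hf : (Finset.univ.filter fun w => f w = 0).card < 2 * Fintype.card α) :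
    ∃ r, rowZeros f r < 2 := by
  by_contra hcon
  push Not at hcon
  have := Finset.sum_le_sum fun j (_ : j ∈ Finset.univ) => hcon j
  rw [sum_rowZeros, Finset.sum_const, Finset.card_univ, smul_eq_mul] at this
  omega

theorem exists_ne_zero_of_rowZeros_lt_two (hβ : 2 ≤ Fintype.card β) {r : α}
    (hr : rowZeros f r < 2) : ∃ x, f (r, x) ≠ 0 := by
  by_contra hcon
  push Not at hcon
  have : rowZeros f r = Fintype.card β := by
    unfold rowZeros
    rw [Finset.filter_true_of_mem fun x _ => hcon x, Finset.card_univ]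
  omega

theorem exists_third {ι : Type*} [Fintype ι] (hι : 3 ≤ Fintype.card ι) (a b : ι) :
    ∃ z, z ≠ a ∧ z ≠ b := by
  classical
  have h1 : ({a, b} : Finset ι).card < (Finset.univ : Finset ι).card :=
    Finset.card_le_two.trans_lt (by rw [Finset.card_univ]; omega)
  obtain ⟨z, -, hz⟩ := Finset.exists_mem_notMem_of_card_lt_card h1
  exact ⟨z, by simpa using hz⟩


/-- On a torus with fewer rows than columns and at most `2K - 1` empty sites before and after the
removal of one particle and the addition of another, the type of the rows with at most one empty
site does not change. -/
theorem RowsOfType.step_torus_of_lt {c : C} (hα : 2 ≤ Fintype.card α)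
    (hαβ : Fintype.card α < Fintype.card β) (h6 : 6 ≤ Fintype.card α + Fintype.card β)
    (hsg : Separating 2 g) (hsf : Separating 2 f) (hsh : Separating 2 h)
    (hf : (Finset.univ.filter fun w => f w = 0).card + 1 ≤ 2 * Fintype.card α)
    (hh : (Finset.univ.filter fun w => h w = 0).card + 1 ≤ 2 * Fintype.card α)
    (Hf : AddAt g f u) (Hh : AddAt g h v) (hc : RowsOfType 2 f c) : RowsOfType 2 h c := by
  classical
  intro r' y hr' hy
  by_contra hne
  have hg := Hf.card_zeros_le
  have : Nonempty β := Fintype.card_pos_iff.1 (by omega)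
  by_cases hgood : ∃ r, rowZeros g r < 2
  · obtain ⟨r, hr⟩ := hgood
    obtain ⟨x₀, h0⟩ := exists_ne_zero_of_rowZeros_lt_two (by omega) hr
    have h1 : g (r, x₀) = c := by
      rw [← Hf.eq_of_ne_zero h0]
      exact hc r x₀ ((Hf.rowZeros_le r).trans_lt hr) (by rwa [Hf.eq_of_ne_zero h0])
    have h2 := Hh.eq_of_ne_zero h0
    have := two_mul_card_le_zeros_of_rows (x := x₀) (y := y) hsh ((Hh.rowZeros_le r).trans_lt hr)
      hr' (by rwa [h2]) hy (by rw [h2, h1]; exact Ne.symm hne)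
    omega
  push Not at hgood
  obtain ⟨r, hr⟩ : ∃ r, rowZeros f r < 2 := exists_rowZeros_lt (by omega)
  have hgu : g u = 0 := by
    by_contra h0
    have := Hf.eq_of_apply_ne_zero h0
    subst this
    have := hgood r
    omega
  have hgv : g v = 0 := by
    by_contra h0
    have := Hh.eq_of_apply_ne_zero h0
    subst this
    have := hgood r'
    omega
  have hru : r = u.1 := by
    by_contra h0
    have := Hf.rowZeros_eq h0
    have := hgood r
    omega
  have hrv : r' = v.1 := by
    by_contra h0
    have := Hh.rowZeros_eq h0
    have := hgood r'
    omega
  have hfu : f u ≠ 0 := by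
    intro h0
    have : g = f := by
      funext w
      by_cases hw : w = u
      · rw [hw, hgu, h0]
      · exact Hf.1 w hw
    subst this
    have := hgood r
    omega
  have hhv : h v ≠ 0 := by
    intro h0
    have : g = h := by
      funext w
      by_cases hw : w = v
      · rw [hw, hgv, h0]
      · exact Hh.1 w hw
    subst this
    have := hgood r'
    omega
  have hfr : ∀ x, f (r, x) ≠ 0 → f (r, x) = c := fun x hx => hc r x hr hx
  have hhr : ∀ x, h (r', x) ≠ 0 → h (r', x) ≠ c := fun x hx0 hx => hne
    ((hsh.row_eq hr' hy hx0).trans hx)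
  have hgr : ∀ x, x ≠ u.2 → g (r, x) = f (r, x) := fun x hx =>
    Hf.1 _ fun h => hx (congrArg Prod.snd h)
  have hgr' : ∀ x, x ≠ v.2 → g (r', x) = h (r', x) := fun x hx =>
    Hh.1 _ fun h => hx (congrArg Prod.snd h)
  have hru' : (r, u.2) = u := Prod.ext hru rfl
  have hrv' : (r', v.2) = v := Prod.ext hrv rfl
  -- `a` and `b` are the second empty sites of the rows of `u` and `v` in `g`
  obtain ⟨a, ha0⟩ := exists_unique_zero_of_rowZeros_lt_two hr
  obtain ⟨b, hb0⟩ := exists_unique_zero_of_rowZeros_lt_two hr'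
  have hga : g (r, a) = 0 ∧ a ≠ u.2 := by
    have h1 := Hf.rowZeros_add_one hgu hfu
    rw [← hru] at h1
    have h2 := hgood r
    obtain ⟨z, hz⟩ := Finset.card_pos.1 (show 0 < rowZeros f r by omega)
    have hz0 : f (r, z) = 0 := (Finset.mem_filter.1 hz).2
    have hza : z = a := by
      by_contra h3
      exact ha0 z h3 hz0
    subst hza
    have : z ≠ u.2 := by
      rintro rfl
      rw [hru'] at hz0
      exact hfu hz0
    exact ⟨(hgr z this).trans hz0, this⟩
  have hgb : g (r', b) = 0 ∧ b ≠ v.2 := by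
    have h1 := Hh.rowZeros_add_one hgv hhv
    rw [← hrv] at h1
    have h2 := hgood r'
    obtain ⟨z, hz⟩ := Finset.card_pos.1 (show 0 < rowZeros h r' by omega)
    have hz0 : h (r', z) = 0 := (Finset.mem_filter.1 hz).2
    have hzb : z = b := by
      by_contra h3
      exact hb0 z h3 hz0
    subst hzb
    have : z ≠ v.2 := by
      rintro rfl
      rw [hrv'] at hz0
      exact hhv hz0
    exact ⟨(hgr' z this).trans hz0, this⟩
  have hgrz : ∀ z, z ≠ u.2 → z ≠ a → g (r, z) ≠ 0 ∧ g (r, z) = c := fun z h1 h2 => by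
    rw [hgr z h1]
    exact ⟨ha0 z h2, hfr z (ha0 z h2)⟩
  have hgrz' : ∀ z, z ≠ v.2 → z ≠ b → g (r', z) ≠ 0 ∧ g (r', z) ≠ c := fun z h1 h2 => by
    rw [hgr' z h1]
    exact ⟨hb0 z h2, hhr z (hb0 z h2)⟩
  have hrr : r ≠ r' := by
    rintro rfl
    obtain ⟨z, hz1, hz2⟩ := exists_third (show 3 ≤ Fintype.card β by omega) u.2 a
    have h1 := hgrz z hz1 hz2
    have h2 : h (r, z) = g (r, z) := Hh.eq_of_ne_zero h1.1
    exact hhr z (by rw [h2]; exact h1.1) (h2.trans h1.2)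
  have hfc : f u = c := by
    have := hfr u.2
    rw [hru'] at this
    exact this hfu
  have hhc : h v ≠ c := by
    have := hhr v.2
    rw [hrv'] at this
    exact this hhv
  have hfz := Hf.colZeros_add_one hgu hfu
  have hhz := Hh.colZeros_add_one hgv hhv
  have hzv : ∀ z, z = v.2 → g (r', z) = 0 := by
    rintro z rfl
    rw [hrv', hgv]
  have hzu : ∀ z, z = u.2 → g (r, z) = 0 := by
    rintro z rfl
    rw [hru', hgu]
  have key : ∀ z, 2 ≤ colZeros g z + (if z = a then 1 else 0) + (if z = b then 1 else 0) := by
    intro z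
    by_cases h1 : g (r, z) = 0
    · by_cases h2 : g (r', z) = 0
      · have := two_le_colZeros hrr h1 h2
        omega
      · by_cases hza : z = a
        · have := one_le_colZeros h1
          rw [if_pos hza]
          omega
        · have hzu : z = u.2 := by
            by_contra h0
            exact (hgrz z h0 hza).1 h1
          have h3 : f (r', z) = g (r', z) := Hf.eq_of_ne_zero h2
          have h4 := hsf.2 z r r' (by rw [hzu, hru']; exact hfu) (by rwa [h3]) (by
            rw [h3, hzu, hru', hfc, ← hzu]
            refine (hgrz' z (fun h0 => h2 (hzv z h0)) fun h0 => h2 (by rw [h0, hgb.1])).2.symm)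
          rw [← hzu] at hfz
          omega
    · have hz1 := hgrz z (fun h0 => h1 (hzu z h0)) fun h0 => h1 (by rw [h0, hga.1])
      by_cases h2 : g (r', z) = 0
      · by_cases hzb : z = b
        · have := one_le_colZeros h2
          rw [if_pos hzb]
          omega
        · have hzv : z = v.2 := by
            by_contra h0
            exact (hgrz' z h0 hzb).1 h2
          have h3 : h (r, z) = g (r, z) := Hh.eq_of_ne_zero h1
          have h4 := hsh.2 z r r' (by rwa [h3]) (by rw [hzv, hrv']; exact hhv) (by
            rw [h3, hz1.2, hzv, hrv']
            exact hhc.symm)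
          rw [← hzv] at hhz
          omega
      · have hz2 := hgrz' z (fun h0 => h2 (hzv z h0)) fun h0 => h2 (by rw [h0, hgb.1])
        have := hsg.2 z r r' h1 h2 (by rw [hz1.2]; exact hz2.2.symm)
        omega
  -- the column of `u` has one empty site more than that, unless there are only two rows
  have key' : 3 ≤ Fintype.card α →
      3 ≤ colZeros g u.2 + (if u.2 = a then 1 else 0) + (if u.2 = b then 1 else 0) := by
    intro hα3
    have hzr := hzu u.2 rfl
    by_cases h2 : g (r', u.2) = 0
    · have h3 := two_le_colZeros hrr hzr h2
      by_cases hub : u.2 = b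
      · rw [if_pos hub]
        omega
      · have huv : u.2 = v.2 := by
          by_contra h0
          exact (hgrz' _ h0 hub).1 h2
        -- a third site of the column would be of the type of `u` as well as of that of `v`
        by_contra hlt
        have h4 : colZeros g u.2 = 2 := by omega
        obtain ⟨i, hi1, hi2⟩ := exists_third hα3 r r'
        have hi0 : g (i, u.2) ≠ 0 := by
          intro h0
          have h5 : ({r, r', i} : Finset α).card ≤ colZeros g u.2 := by
            refine Finset.card_le_card fun j hj => ?_
            rw [Finset.mem_insert, Finset.mem_insert, Finset.mem_singleton] at hj
            rcases hj with rfl | rfl | rfl <;> simpa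
          rw [Finset.card_eq_three.2 ⟨r, r', i, hrr, hi1.symm, hi2.symm, rfl⟩] at h5
          omega
        have h5 : f (i, u.2) = c := by
          have h6 : f (i, u.2) = f (r, u.2) := by
            refine hsf.col_eq (by omega) ?_ ?_
            · rwa [Hf.eq_of_ne_zero hi0]
            · rwa [hru']
          rw [h6, hru', hfc]
        have h6 : h (i, u.2) = h v := by
          have h7 : h (i, v.2) = h (r', v.2) := by
            rw [← huv] at hhz
            refine hsh.col_eq (by rw [← huv]; omega) ?_ ?_
            · rw [← huv]
              rwa [Hh.eq_of_ne_zero hi0]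
            · rwa [hrv']
          rw [huv, h7, hrv']
        rw [Hf.eq_of_ne_zero hi0] at h5
        rw [Hh.eq_of_ne_zero hi0, h5] at h6
        exact hhc h6.symm
    · have h3 : f (r', u.2) = g (r', u.2) := Hf.eq_of_ne_zero h2
      have h4 := hsf.2 u.2 r r' (by rw [hru']; exact hfu) (by rwa [h3]) (by
        rw [h3, hru', hfc]
        exact (hgrz' _ (fun h0 => h2 (hzv _ h0)) fun h0 => h2 (by rw [h0, hgb.1])).2.symm)
      omega
  by_cases hα3 : 3 ≤ Fintype.card α
  · have key2 : ∀ z, 2 + (if z = u.2 then 1 else 0) ≤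
        colZeros g z + (if z = a then 1 else 0) + (if z = b then 1 else 0) := by
      intro z
      by_cases hz : z = u.2
      · rw [if_pos hz, hz]
        exact key' hα3
      · rw [if_neg hz]
        exact key z
    have := Finset.sum_le_sum fun z (_ : z ∈ Finset.univ) => key2 z
    rw [Finset.sum_add_distrib, Finset.sum_add_distrib, Finset.sum_add_distrib, sum_ite_eq_one,
      sum_ite_eq_one, sum_ite_eq_one, sum_colZeros, Finset.sum_const, Finset.card_univ,
      smul_eq_mul] at this
    omega
  · have := Finset.sum_le_sum fun z (_ : z ∈ Finset.univ) => key z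
    rw [Finset.sum_add_distrib, Finset.sum_add_distrib, sum_ite_eq_one,
      sum_ite_eq_one, sum_colZeros, Finset.sum_const, Finset.card_univ,
      smul_eq_mul] at this
    omega

/-- On a square torus with at most `2K - 2` empty sites before and after the removal of one
particle and the addition of another, the type of the rows with at most one empty site does not
change. Configurations with two such rows of different types exist, but they have exactly two
empty sites in every other row and cannot be entered. -/
theorem RowsOfType.step_torus_of_eq {c : C} (hα : 3 ≤ Fintype.card α)
    (hαβ : Fintype.card α = Fintype.card β) (hsf : Separating 2 f) (hsh : Separating 2 h)
    (hf : (Finset.univ.filter fun w => f w = 0).card + 2 ≤ 2 * Fintype.card α)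
    (hh : (Finset.univ.filter fun w => h w = 0).card + 2 ≤ 2 * Fintype.card α)
    (Hf : AddAt g f u) (Hh : AddAt g h v) (hc : RowsOfType 2 f c) : RowsOfType 2 h c := by
  classical
  intro r' y hr' hy
  by_contra hne
  have hg := Hf.card_zeros_le
  have : Nonempty β := Fintype.card_pos_iff.1 (by omega)
  obtain ⟨r, hgr⟩ : ∃ r, rowZeros g r < 2 := exists_rowZeros_lt (by omega)
  obtain ⟨x₀, hx₀⟩ := exists_ne_zero_of_rowZeros_lt_two (by omega) hgr
  have hfr : rowZeros f r < 2 := (Hf.rowZeros_le r).trans_lt hgr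
  have hr : rowZeros h r < 2 := (Hh.rowZeros_le r).trans_lt hgr
  have hfx₀ := Hf.eq_of_ne_zero hx₀
  have hhx₀ := Hh.eq_of_ne_zero hx₀
  have hcx₀ : g (r, x₀) = c := by
    rw [← hfx₀]
    exact hc r x₀ hfr (by rwa [hfx₀])
  have hhc : ∀ z, h (r, z) ≠ 0 → h (r, z) = c := fun z hz => by
    rw [← hcx₀, ← hhx₀]
    exact hsh.row_eq hr hz (by rwa [hhx₀])
  have hhc' : ∀ z, h (r', z) ≠ 0 → h (r', z) ≠ c := fun z hz h0 => hne
    ((hsh.row_eq hr' hy hz).trans h0)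
  obtain ⟨e, he⟩ := exists_unique_zero_of_rowZeros_lt_two hr
  obtain ⟨e', he'⟩ := exists_unique_zero_of_rowZeros_lt_two hr'
  have hcol := two_le_colZeros_add hsh hr hr' he he' (x := x₀) (by rwa [hhx₀]) hy
    (by rw [hhx₀, hcx₀]; exact Ne.symm hne)
  have hsum : ∑ z, (colZeros h z + (if z = e then 1 else 0) + (if z = e' then 1 else 0)) =
      (Finset.univ.filter fun w => h w = 0).card + 1 + 1 := by
    rw [Finset.sum_add_distrib, Finset.sum_add_distrib, sum_ite_eq_one, sum_ite_eq_one,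
      sum_colZeros]
  have hsum2 : ∑ _z : β, 2 = 2 * Fintype.card β := by
    rw [Finset.sum_const, Finset.card_univ, smul_eq_mul, mul_comm]
  have hle := Finset.sum_le_sum fun z (_ : z ∈ Finset.univ) => hcol z
  rw [hsum, hsum2] at hle
  -- all column counts are attained
  have hcol_eq : ∀ z, colZeros h z + (if z = e then 1 else 0) + (if z = e' then 1 else 0) = 2 := by
    intro z
    refine ((Finset.sum_eq_sum_iff_of_le fun z _ => hcol z).1 ?_ z (Finset.mem_univ z)).symm
    rw [hsum, hsum2]
    omega
  have hmix : ∀ z, h (r, z) ≠ 0 → h (r', z) ≠ 0 → 2 ≤ colZeros h z := fun z h1 h2 =>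
    hsh.2 z r r' h1 h2 (by rw [hhc z h1]; exact (hhc' z h2).symm)
  have hee : e ≠ e' := by
    rintro rfl
    have h0 := hcol_eq e
    rw [if_pos rfl] at h0
    have h1 : h (r, e) ≠ 0 := fun h1 => by
      have := one_le_colZeros h1
      omega
    have h2 : h (r', e) ≠ 0 := fun h1 => by
      have := one_le_colZeros h1
      omega
    have := hmix e h1 h2
    omega
  have hce : colZeros h e = 1 := by
    have := hcol_eq e
    rw [if_pos rfl, if_neg hee] at this
    omega
  have hce' : colZeros h e' = 1 := by
    have := hcol_eq e'
    rw [if_pos rfl, if_neg hee.symm] at this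
    omega
  have hre : h (r, e) = 0 := by
    by_contra h0
    have := hmix e h0 (he' e hee)
    omega
  have hre' : h (r', e') = 0 := by
    by_contra h0
    have := hmix e' (he e' hee.symm) h0
    omega
  have hrr : r ≠ r' := by
    rintro rfl
    exact he e' hee.symm hre'
  have hie : ∀ i, i ≠ r → h (i, e) ≠ 0 ∧ h (i, e) ≠ c := by
    intro i hi
    have h0 : h (i, e) ≠ 0 := fun h0 => by
      have := two_le_colZeros hi h0 hre
      omega
    refine ⟨h0, ?_⟩
    rw [hsh.col_eq (by omega) h0 (he' e hee)]
    exact hhc' e (he' e hee)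
  have hie' : ∀ i, i ≠ r' → h (i, e') ≠ 0 ∧ h (i, e') = c := by
    intro i hi
    have h0 : h (i, e') ≠ 0 := fun h0 => by
      have := two_le_colZeros hi h0 hre'
      omega
    refine ⟨h0, ?_⟩
    rw [hsh.col_eq (by omega) h0 (he e' hee.symm)]
    exact hhc e' (he e' hee.symm)
  have hrz : 1 ≤ rowZeros h r := Finset.card_pos.2 ⟨e, by simpa using hre⟩
  have hrz' : 1 ≤ rowZeros h r' := Finset.card_pos.2 ⟨e', by simpa using hre'⟩
  have hrow : ∀ i, 2 ≤ rowZeros h i + (if i = r then 1 else 0) + (if i = r' then 1 else 0) := by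
    intro i
    by_cases h1 : i = r
    · rw [if_pos h1, h1]
      omega
    · by_cases h2 : i = r'
      · rw [if_pos h2, h2]
        omega
      · have h3 := hie i h1
        have h4 := hie' i h2
        have := hsh.1 i e e' h3.1 h4.1 (by rw [h4.2]; exact h3.2)
        omega
  have hrow_eq : ∀ i, rowZeros h i + (if i = r then 1 else 0) + (if i = r' then 1 else 0) = 2 := by
    intro i
    refine ((Finset.sum_eq_sum_iff_of_le fun i _ => hrow i).1 ?_ i (Finset.mem_univ i)).symm
    have hsum' := Finset.sum_le_sum fun i (_ : i ∈ Finset.univ) => hrow i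
    rw [Finset.sum_add_distrib, Finset.sum_add_distrib, sum_ite_eq_one, sum_ite_eq_one,
      sum_rowZeros, Finset.sum_const, Finset.card_univ, smul_eq_mul] at hsum' ⊢
    omega
  have hfe : ∀ i, i ≠ r → g (i, e) ≠ 0 → f (i, e) ≠ 0 ∧ f (i, e) ≠ c := fun i hi h0 => by
    rw [Hf.eq_of_ne_zero h0]
    refine ⟨h0, ?_⟩
    rw [← Hh.eq_of_ne_zero h0]
    exact (hie i hi).2
  -- the row of type different from `c` cannot have at most one empty site in `f`
  have hnot : ∀ z, g (r', z) ≠ 0 → ¬ rowZeros f r' < 2 := fun z hz hlt => by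
    have h1 := hc r' z hlt (by rwa [Hf.eq_of_ne_zero hz])
    rw [Hf.eq_of_ne_zero hz, ← Hh.eq_of_ne_zero hz] at h1
    exact hhc' z (by rwa [Hh.eq_of_ne_zero hz]) h1
  have hg2 : 2 ≤ rowZeros g r' := by
    by_contra hlt
    obtain ⟨z, hz⟩ := exists_ne_zero_of_rowZeros_lt_two (by omega) (not_le.1 hlt)
    exact hnot z hz ((Hf.rowZeros_le r').trans_lt (not_le.1 hlt))
  have hvr : r' = v.1 := by
    by_contra h0
    have := Hh.rowZeros_eq h0
    omega
  have hgv : g v = 0 := by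
    by_contra h0
    have := Hh.eq_of_apply_ne_zero h0
    subst this
    omega
  have hhv : h v ≠ 0 := by
    intro h0
    have : g = h := by
      funext w
      by_cases hw : w = v
      · rw [hw, hgv, h0]
      · exact Hh.1 w hw
    subst this
    omega
  have hgr1 : rowZeros g r' = rowZeros h r' + 1 := by
    rw [hvr]
    exact Hh.rowZeros_add_one hgv hhv
  have hgh : ∀ i, i ≠ r' → ∀ z, g (i, z) = h (i, z) := fun i hi z =>
    Hh.1 _ fun h0 => hi ((congrArg Prod.fst h0).trans hvr.symm)
  have hgcard : (Finset.univ.filter fun w => f w = 0).card <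
      (Finset.univ.filter fun w => g w = 0).card := by
    have h1 : ∑ i, rowZeros h i < ∑ i, rowZeros g i :=
      Finset.sum_lt_sum (fun i _ => Hh.rowZeros_le i) ⟨r', Finset.mem_univ _, by omega⟩
    rw [sum_rowZeros, sum_rowZeros] at h1
    omega
  have hgu : g u = 0 := by
    by_contra h0
    have := Hf.eq_of_apply_ne_zero h0
    subst this
    omega
  have hfu : f u ≠ 0 := by
    intro h0
    have : g = f := by
      funext w
      by_cases hw : w = u
      · rw [hw, hgu, h0]
      · exact Hf.1 w hw
    subst this
    omega
  have hfu1 := Hf.rowZeros_add_one hgu hfu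
  have hu1 : u.1 ≠ r' := by
    intro h0
    rw [h0] at hfu1
    obtain ⟨z, hz1, hz2⟩ := exists_third (show 3 ≤ Fintype.card β by omega) v.2 e'
    have h1 : g (r', z) = h (r', z) := Hh.1 _ fun h2 => hz1 (congrArg Prod.snd h2)
    exact hnot z (by rw [h1]; exact he' z hz2) (by omega)
  have hrow_u := hrow_eq u.1
  rw [if_neg hu1] at hrow_u
  have hrow_gh := Hh.rowZeros_eq (j := u.1) (by rw [← hvr]; exact hu1)
  by_cases hur : u.1 = r
  · rw [if_pos hur] at hrow_u
    have hue : u.2 = e := by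
      by_contra h0
      have h1 := hgh u.1 hu1 u.2
      rw [Prod.mk.eta, hgu] at h1
      exact he u.2 h0 (by rw [show (r, u.2) = u from Prod.ext hur.symm rfl]; exact h1.symm)
    have hreu : (r, e) = u := Prod.ext hur.symm hue.symm
    obtain ⟨i, hi, hi'⟩ := exists_third hα r r'
    have h1 := hfe i hi (by rw [hgh i hi']; exact (hie i hi).1)
    have h2 : f (r, e) = c := hc r e hfr (by rwa [hreu])
    have h3 := hsf.2 e r i (by rwa [hreu]) h1.1 (by rw [h2]; exact h1.2.symm)
    have h4 := Hf.colZeros_add_one hgu hfu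
    have h5 := Hh.colZeros_le_add_one e
    rw [hue] at h4
    omega
  · rw [if_neg hur] at hrow_u
    have h1 := hfe u.1 hur (by rw [hgh _ hu1]; exact (hie _ hur).1)
    have h2 : g (u.1, e') = h (u.1, e') := hgh _ hu1 e'
    have h3 : f (u.1, e') = h (u.1, e') := by
      rw [← h2]
      exact Hf.eq_of_ne_zero (by rw [h2]; exact (hie' _ hu1).1)
    have h4 := hsf.1 u.1 e e' h1.1 (by rw [h3]; exact (hie' _ hu1).1) (by
      rw [h3, (hie' _ hu1).2]
      exact h1.2)
    omega

end Rectangles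

end WidomRowlinson

/-! ### The lower bound for the communication height -/

namespace WidomRowlinson

section Invariant

variable {α β : Type*} [Fintype α] [Fintype β] {G : SimpleGraph (α × β)} {M : ℕ}

theorem AddAt.card_zeros_lt {C : Type*} [Zero C] [DecidableEq C] {g f : α × β → C} {u : α × β}
    (H : AddAt g f u) (hg : g u = 0) (hf : f u ≠ 0) :
    (Finset.univ.filter fun w => f w = 0).card < (Finset.univ.filter fun w => g w = 0).card := by
  refine Finset.card_lt_card (Finset.ssubset_iff_subset_ne.2 ⟨fun w hw => ?_, fun heq => ?_⟩)
  · rw [Finset.mem_filter] at hw ⊢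
    refine ⟨hw.1, ?_⟩
    by_contra hc
    exact hc ((H.eq_of_ne_zero hc).symm.trans hw.2)
  · have : u ∈ Finset.univ.filter fun w => f w = 0 := by
      rw [heq]
      simpa using hg
    exact hf (by simpa using this)

/-- If the type of the rows survives the removal of one particle followed by the addition of
another whenever there are at most `m` empty sites before and after, then it survives along every
path with at most `m + 1` empty sites. Configurations with `m + 1` empty sites, which need not have
a row type, are controlled through those that arise from them by adding a particle. -/
theorem RowsOfType.of_reach {t m : ℕ} {c : Fin (M + 1)}
    (step : ∀ (g f h : Config G M) (u v : α × β), empties f ≤ m → empties h ≤ m →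
      AddAt g.1 f.1 u → AddAt g.1 h.1 v → RowsOfType t f.1 c → RowsOfType t h.1 c)
    {σ η : Config G M} (h : Reach (m + 1) σ η) (hσ : empties σ = 0)
    (hη : empties η ≤ m) (hc : RowsOfType t σ.1 c) : RowsOfType t η.1 c := by
  have key : ∀ (ζ : Config G M) (v : α × β), AddAt η.1 ζ.1 v → empties ζ ≤ m →
      RowsOfType t ζ.1 c := by
    clear hη
    induction h with
    | refl =>
      intro ζ v hv _
      have : σ.1 v ≠ 0 := fun h0 =>
        (Finset.filter_eq_empty_iff.1 (Finset.card_eq_zero.1 hσ)) (Finset.mem_univ v) h0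
      rw [← hv.eq_of_apply_ne_zero this]
      exact hc
    | @tail ξ η _ hs ih =>
      obtain ⟨hd, hξ, hη⟩ := hs
      obtain ⟨v, hv, hv0⟩ := exists_site_of_siteDist_eq_one hd
      intro ζ w hw hζ
      by_cases h1 : η.1 v = 0
      · by_cases h2 : ξ.1 v = 0
        · have : ξ = η := by
            apply Subtype.ext
            funext z
            by_cases hz : z = v
            · rw [hz, h1, h2]
            · exact hv z hz
          subst this
          exact ih ζ w hw hζ
        · have H : AddAt η.1 ξ.1 v := ⟨fun z hz => (hv z hz).symm, Or.inl h1⟩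
          have h3 : empties ξ < empties η := H.card_zeros_lt h1 h2
          exact step η ξ ζ v w (by omega) hζ H hw
            (ih ξ v ⟨fun _ _ => rfl, Or.inr rfl⟩ (by omega))
      · have h2 : ξ.1 v = 0 := hv0.resolve_right h1
        have H : AddAt ξ.1 η.1 v := ⟨hv, Or.inl h2⟩
        have h3 : empties η < empties ξ := H.card_zeros_lt h2 h1
        exact step η η ζ v w (by omega) hζ ⟨fun _ _ => rfl, Or.inr rfl⟩ hw
          (ih η v H (by omega))
  by_cases hV : Nonempty (α × β)
  · exact key η hV.some ⟨fun _ _ => rfl, Or.inr rfl⟩ hη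
  · intro j x
    exact absurd ⟨(j, x)⟩ hV

end Invariant

section LowerBound

variable {K L M : ℕ}

theorem rowsOfType_const {t : ℕ} {G : SimpleGraph (Fin K × Fin L)} (a : Fin (M + 1)) :
    RowsOfType t (Config.const G a).1 a := fun _ _ _ _ => rfl

theorem eq_of_rowsOfType_const {t : ℕ} (hK : 2 ≤ K) (hL : 2 ≤ L) (ht : 0 < t)
    {G : SimpleGraph (Fin K × Fin L)} {b c : Fin (M + 1)} (hb : b ≠ 0)
    (h : RowsOfType t (Config.const G b).1 c) : b = c := by
  refine h ⟨0, by omega⟩ ⟨0, by omega⟩ ?_ hb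
  have : rowZeros (Config.const G b).1 ⟨0, by omega⟩ = 0 :=
    Finset.card_eq_zero.2 (Finset.filter_eq_empty_iff.2 fun _ _ => hb)
  omega

/-- The lower bound for lattices with at most as many rows as columns. -/
theorem barrier_le_of_reach_of_le (hK : 2 ≤ K) (hKL : K ≤ L) {bc : Boundary}
    (hbc : bc = Boundary.periodic → 6 ≤ K + L) {a b : Fin (M + 1)} (ha : a ≠ 0) (hb : b ≠ 0)
    (hab : a ≠ b) {B : ℕ} (h : Reach B (Config.const (lattice K L bc) a) (Config.const _ b)) :
    barrier K L bc ≤ B := by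
  by_contra hlt
  rw [not_le] at hlt
  have hL : 2 ≤ L := hK.trans hKL
  have he := empties_const (lattice K L bc) ha
  have he' := empties_const (lattice K L bc) hb
  have hα : Fintype.card (Fin K) = K := Fintype.card_fin K
  have hβ : Fintype.card (Fin L) = L := Fintype.card_fin L
  have hs := fun σ : Config (lattice K L bc) M => σ.separating hK hL
  refine hab.symm ?_
  cases bc with
  | free =>
    have hB : barrier K L .free = K + 1 := by
      show min K L + 1 = K + 1
      omega
    have h' : Reach (K - 1 + 1) _ _ := h.mono (by omega)
    refine eq_of_rowsOfType_const hK hL one_pos hb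
      (RowsOfType.of_reach (fun g f h u v hf hh Hf Hh hc => ?_) h' he (by omega)
        (rowsOfType_const a))
    unfold empties at hf hh
    exact hc.step_path (by omega) (by omega) (hs g) (hs f) (hs h) (by omega) (by omega) Hf Hh
  | periodic =>
    have h6 := hbc rfl
    rcases Nat.eq_or_lt_of_le hKL with rfl | hKL
    · have hB : barrier K K .periodic = 2 * K := if_pos rfl
      have h' : Reach (2 * K - 2 + 1) _ _ := h.mono (by omega)
      refine eq_of_rowsOfType_const hK hL two_pos hb
        (RowsOfType.of_reach (fun g f h u v hf hh Hf Hh hc => ?_) h' he (by omega)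
          (rowsOfType_const a))
      unfold empties at hf hh
      exact hc.step_torus_of_eq (by omega) rfl (hs f) (hs h) (by omega) (by omega) Hf Hh
    · have hB : barrier K L .periodic = 2 * K + 1 := by
        show (if K = L then 2 * K else min (2 * K) (2 * L) + 1) = 2 * K + 1
        rw [if_neg (by omega)]
        omega
      have h' : Reach (2 * K - 1 + 1) _ _ := h.mono (by omega)
      refine eq_of_rowsOfType_const hK hL two_pos hb
        (RowsOfType.of_reach (fun g f h u v hf hh Hf Hh hc => ?_) h' he (by omega)
          (rowsOfType_const a))
      unfold empties at hf hh
      exact hc.step_torus_of_lt (by omega) (by omega) (by omega) (hs g) (hs f) (hs h) (by omega)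
        (by omega) Hf Hh

theorem barrier_comm (K L : ℕ) (bc : Boundary) : barrier K L bc = barrier L K bc := by
  cases bc with
  | free => exact congrArg (· + 1) (min_comm K L)
  | periodic =>
    show (if K = L then 2 * K else min (2 * K) (2 * L) + 1)
      = (if L = K then 2 * L else min (2 * L) (2 * K) + 1)
    split_ifs <;> omega

theorem barrier_le_of_reach (hK : 2 ≤ K) (hL : 2 ≤ L) {bc : Boundary}
    (hbc : bc = Boundary.periodic → 6 ≤ K + L) {a b : Fin (M + 1)} (ha : a ≠ 0) (hb : b ≠ 0)
    (hab : a ≠ b) {B : ℕ} (h : Reach B (Config.const (lattice K L bc) a) (Config.const _ b)) :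
    barrier K L bc ≤ B := by
  rcases le_total K L with hKL | hKL
  · exact barrier_le_of_reach_of_le hK hKL hbc ha hb hab h
  · rw [barrier_comm]
    exact barrier_le_of_reach_of_le hL hKL (fun h => by have := hbc h; omega) ha hb hab
      (h.comap (latticeSwap L K bc))

end LowerBound

end WidomRowlinson

/-! ### Sweeping a region with one type -/

namespace WidomRowlinson

section Sweep

open Classical in
/-- The result of sweeping the region `S` with particles of type `b`: the sites of `S` are occupied
by `b`, all particles of other types are removed from the shield `D`, and the other sites are as
in `σ`. -/
noncomputable def sweepFun {V C : Type*} [Zero C] (σ : V → C) (b : C) (S D : Set V) : V → C :=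
  fun v => if v ∈ S then b else if v ∈ D ∧ σ v ≠ b then 0 else σ v

variable {V : Type*} {G : SimpleGraph V} {M : ℕ}

/-- The configuration with values `sweepFun`, for a shield that contains the outer boundary of the
swept region. -/
noncomputable def Config.sweep (σ : Config G M) (b : Fin (M + 1)) (S D : Set V)
    (h : ∀ v w, G.Adj v w → v ∈ S → w ∈ S ∨ w ∈ D) : Config G M :=
  ⟨sweepFun σ.1 b S D, fun v w hvw => by
    have h1 := h v w hvw
    have h2 := h w v hvw.symm
    have h3 := σ.2 v w hvw
    unfold sweepFun
    by_cases hv : v ∈ S <;> by_cases hw : w ∈ S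
    · simp [hv, hw]
    · have hD := (h1 hv).resolve_left hw
      by_cases hb : σ.1 w = b <;> simp [hv, hw, hD, hb]
    · have hD := (h2 hw).resolve_left hv
      by_cases hb : σ.1 v = b <;> simp [hv, hw, hD, hb]
    · rw [if_neg hv, if_neg hw]
      split_ifs <;> simp_all⟩

variable [Fintype V]

open Classical in
/-- The empty sites of a swept configuration. -/
noncomputable def sweepZeros {C : Type*} [Zero C] (σ : V → C) (b : C) (S D : Set V) : Finset V :=
  Finset.univ.filter fun v => v ∉ S ∧ (σ v = 0 ∨ (v ∈ D ∧ σ v ≠ b))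

theorem mem_sweepZeros {C : Type*} [Zero C] {σ : V → C} {b : C} {S D : Set V} {v : V} :
    v ∈ sweepZeros σ b S D ↔ v ∉ S ∧ (σ v = 0 ∨ (v ∈ D ∧ σ v ≠ b)) := by
  simp [sweepZeros]

theorem empties_sweep_le {σ : Config G M} {b : Fin (M + 1)} (hb : b ≠ 0) {S D : Set V}
    (h : ∀ v w, G.Adj v w → v ∈ S → w ∈ S ∨ w ∈ D) :
    empties (σ.sweep b S D h) ≤ (sweepZeros σ.1 b S D).card := by
  refine Finset.card_le_card fun v hv => ?_
  have hv' : sweepFun σ.1 b S D v = 0 := (Finset.mem_filter.1 hv).2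
  refine mem_sweepZeros.2 ?_
  unfold sweepFun at hv'
  split_ifs at hv' with h1 h2
  · exact absurd hv' hb
  · exact ⟨h1, Or.inr h2⟩
  · exact ⟨h1, Or.inl hv'⟩

/-- Two sweeps of the same configuration are joined through the sweep with the smaller region and
the larger shield. -/
theorem Reach.sweep_step {σ : Config G M} {b : Fin (M + 1)} (hb : b ≠ 0) {B : ℕ}
    {S S' D D' D₁ : Set V}
    (h : ∀ v w, G.Adj v w → v ∈ S → w ∈ S ∨ w ∈ D)
    (h' : ∀ v w, G.Adj v w → v ∈ S' → w ∈ S' ∨ w ∈ D')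
    (hS : S ⊆ S') (hS' : S' ⊆ S ∪ D₁) (hD : D ⊆ D₁) (hD' : D' ⊆ D₁)
    (hB : (sweepZeros σ.1 b S D₁).card ≤ B) :
    Reach B (σ.sweep b S D h) (σ.sweep b S' D' h') := by
  have h₁ : ∀ v w, G.Adj v w → v ∈ S → w ∈ S ∨ w ∈ D₁ := fun v w hvw hv =>
    (h v w hvw hv).imp_right fun hw => hD hw
  refine Reach.of_common_sub (τ := σ.sweep b S D₁ h₁) (fun w => ?_) (fun w => ?_)
    ((empties_sweep_le hb h₁).trans hB)
  · show sweepFun _ _ _ _ w = 0 ∨ sweepFun _ _ _ _ w = sweepFun _ _ _ _ w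
    unfold sweepFun
    by_cases hw : w ∈ S
    · simp [hw]
    · by_cases hw1 : w ∈ D₁
      · by_cases hσ : σ.1 w = b <;> simp [hw, hw1, hσ]
      · have hw2 : w ∉ D := fun h => hw1 (hD h)
        simp [hw, hw1, hw2]
  · show sweepFun _ _ _ _ w = 0 ∨ sweepFun _ _ _ _ w = sweepFun _ _ _ _ w
    unfold sweepFun
    by_cases hw : w ∈ S
    · simp [hw, hS hw]
    · by_cases hw1 : w ∈ D₁
      · by_cases hσ : σ.1 w = b <;> simp [hw, hw1, hσ]
      · have hw2 : w ∉ D' := fun h => hw1 (hD' h)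
        have hw3 : w ∉ S' := fun h => (hS' h).elim hw hw1
        simp [hw, hw1, hw2, hw3]

/-- Integer-valued functions that change by at most one along every edge. -/
def Lip {ι : Type*} (H : SimpleGraph ι) (p : ι → ℤ) : Prop := ∀ i j, H.Adj i j → p i ≤ p j + 1

/-- Between two such functions one can pass by lowering single values by one: a largest value
among those that still have to be lowered may always be lowered. -/
theorem Lip.descend {ι : Type*} [Fintype ι] [DecidableEq ι] {H : SimpleGraph ι} {p₀ p' : ι → ℤ}
    (h₀ : Lip H p₀) (h' : Lip H p') (hle : p' ≤ p₀) {T : (ι → ℤ) → Prop}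
    (step : ∀ p i, Lip H p → Lip H (Function.update p i (p i - 1)) → p' ≤ p → p ≤ p₀ →
      T p → T (Function.update p i (p i - 1))) (hT : T p₀) : T p' := by
  suffices key : ∀ n : ℕ, ∀ p, Lip H p → p' ≤ p → p ≤ p₀ → (∑ i, (p i - p' i)) = n → T p → T p' by
    refine key (∑ i, (p₀ i - p' i)).toNat p₀ h₀ hle le_rfl ?_ hT
    rw [Int.toNat_of_nonneg (Finset.sum_nonneg fun i _ => sub_nonneg.2 (hle i))]
  intro n
  induction n with
  | zero =>
    intro p _ hp' _ hs hTp
    have : p' = p := by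
      funext i
      have := (Finset.sum_eq_zero_iff_of_nonneg fun i _ => sub_nonneg.2 (hp' i)).1
        (by exact_mod_cast hs) i (Finset.mem_univ i)
      omega
    rwa [this]
  | succ n ih =>
    intro p hp hp' hp₀ hs hTp
    obtain ⟨i₀, hi₀⟩ : ∃ i, p' i < p i := by
      by_contra hc
      push Not at hc
      have : ∑ i, (p i - p' i) ≤ 0 := Finset.sum_nonpos fun i _ => by
        have := hc i
        omega
      omega
    obtain ⟨i, hi, hmax⟩ := Finset.exists_max_image (Finset.univ.filter fun i => p' i < p i) p
      ⟨i₀, by simpa using hi₀⟩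
    have hi' : p' i < p i := (Finset.mem_filter.1 hi).2
    have hup : p' ≤ Function.update p i (p i - 1) := by
      intro j
      by_cases hj : j = i
      · subst hj
        rw [Function.update_self]
        exact Int.le_sub_one_of_lt hi'
      · rw [Function.update_of_ne hj]
        exact hp' j
    have hL : Lip H (Function.update p i (p i - 1)) := by
      intro j k hjk
      have h1 := hp j k hjk
      by_cases hj : j = i
      · subst hj
        rw [Function.update_self, Function.update_of_ne hjk.ne']
        omega
      · by_cases hk : k = i
        · subst hk
          rw [Function.update_self, Function.update_of_ne hj]
          by_cases hlt : p' j < p j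
          · have := hmax j (by simpa using hlt)
            omega
          · have h2 := h' j k hjk
            have h3 := hp' j
            omega
        · rw [Function.update_of_ne hj, Function.update_of_ne hk]
          exact h1
    refine ih _ hL hup (fun j => ?_) ?_ (step p i hp hL hp' hp₀ hTp)
    · by_cases hj : j = i
      · subst hj
        rw [Function.update_self]
        exact (Int.sub_le_self _ zero_le_one).trans (hp₀ j)
      · rw [Function.update_of_ne hj]
        exact hp₀ j
    · have h1 : ∑ j, (Function.update p i (p i - 1) j - p' j) =
          ∑ j, ((p j - p' j) - if j = i then 1 else 0) := by
        refine Finset.sum_congr rfl fun j _ => ?_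
        by_cases hj : j = i
        · subst hj
          rw [Function.update_self, if_pos rfl]
          omega
        · rw [Function.update_of_ne hj, if_neg hj]
          omega
      rw [h1, Finset.sum_sub_distrib, hs, Finset.sum_ite_eq' Finset.univ i fun _ => (1 : ℤ),
        if_pos (Finset.mem_univ i)]
      push_cast
      omega

/-- A family of regions and shields indexed by Lipschitz functions, growing by one site when the
function is lowered at one place, can be swept at the cost of one more empty site than the
configurations of the family have. -/
theorem Reach.sweep {ι : Type*} [Fintype ι] [DecidableEq ι] {H : SimpleGraph ι}
    {S D : (ι → ℤ) → Set V} (hbd : ∀ p, Lip H p → ∀ v w, G.Adj v w → v ∈ S p → w ∈ S p ∨ w ∈ D p)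
    (hS : ∀ p i, S p ⊆ S (Function.update p i (p i - 1)))
    (hS' : ∀ p i, S (Function.update p i (p i - 1)) ⊆ S p ∪ D p)
    (hD : ∀ p i, ∃ z, D (Function.update p i (p i - 1)) ⊆ D p ∪ {z})
    {σ : Config G M} {b : Fin (M + 1)} (hb : b ≠ 0) {B : ℕ} {p₀ p' : ι → ℤ}
    (h₀ : Lip H p₀) (h' : Lip H p') (hle : p' ≤ p₀) (hσ : ∀ v ∈ S p₀, σ.1 v = b)
    (hB : ∀ p, p' ≤ p → p ≤ p₀ → (sweepZeros σ.1 b (S p) (D p)).card + 1 ≤ B) :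
    ∃ η : Config G M, (∀ v, η.1 v = sweepFun σ.1 b (S p') (D p') v) ∧ Reach B σ η := by
  classical
  suffices key : ∃ hp, Reach B σ (σ.sweep b (S p') (D p') (hbd p' hp)) by
    obtain ⟨hp, h⟩ := key
    exact ⟨_, fun v => rfl, h⟩
  refine h₀.descend h' hle (T := fun p => ∃ hp, Reach B σ (σ.sweep b (S p) (D p) (hbd p hp)))
    ?_ ⟨h₀, ?_⟩
  · rintro p i - hL hp' hp₀ ⟨hp, h⟩
    refine ⟨hL, h.trans ?_⟩
    obtain ⟨z, hz⟩ := hD p i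
    refine Reach.sweep_step hb _ _ (hS p i) (D₁ := D p ∪ {z})
      ((hS' p i).trans (Set.union_subset_union_right _ Set.subset_union_left))
      Set.subset_union_left hz ?_
    refine le_trans ?_ (hB p hp' hp₀)
    refine (Finset.card_le_card (t := insert z (sweepZeros σ.1 b (S p) (D p))) fun v hv => ?_).trans
      (Finset.card_insert_le _ _)
    obtain ⟨h1, h2⟩ := mem_sweepZeros.1 hv
    rw [Finset.mem_insert]
    by_cases hvz : v = z
    · exact Or.inl hvz
    · refine Or.inr (mem_sweepZeros.2 ⟨h1, h2.imp_right ?_⟩)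
      rintro ⟨h3, h4⟩
      exact ⟨h3.resolve_right hvz, h4⟩
  · refine Reach.of_sub (fun v => ?_)
      ((empties_sweep_le hb _).trans ((Nat.le_succ _).trans (hB p₀ hle le_rfl)))
    show sweepFun _ _ _ _ v = 0 ∨ sweepFun _ _ _ _ v = _
    unfold sweepFun
    split_ifs with h1 h2
    · exact Or.inr (hσ v h1).symm
    · exact Or.inl rfl
    · exact Or.inr rfl

/-- A sweep of the whole graph ends in a constant configuration. -/
theorem Reach.to_const {σ η : Config G M} {b : Fin (M + 1)} {S D : Set V} {B : ℕ}
    (hη : ∀ v, η.1 v = sweepFun σ.1 b S D v) (hS : ∀ v, v ∈ S) (h : Reach B σ η) :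
    Reach B σ (Config.const G b) := by
  have : η = Config.const G b := by
    apply Subtype.ext
    funext v
    rw [hη v]
    exact if_pos (hS v)
  rwa [← this]

/-- The count that governs the cost of a sweep: the shield, and those empty sites of the original
configuration that lie neither in the swept region nor in the shield. -/
theorem card_sweepZeros_add_le {C : Type*} [Zero C] [DecidableEq C] [DecidableEq V] {σ : V → C}
    {b : C} {S D : Set V} {A E : Finset V} (hA : ∀ v, v ∉ S → v ∈ D → σ v ≠ b → v ∈ A)
    (hE : ∀ v ∈ E, σ v = 0 ∧ (v ∈ S ∨ v ∈ A)) :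
    (sweepZeros σ b S D).card + E.card ≤ (Finset.univ.filter fun v => σ v = 0).card + A.card := by
  have hsub : E ⊆ Finset.univ.filter fun v => σ v = 0 := fun v hv => by simpa using (hE v hv).1
  have h1 : sweepZeros σ b S D ⊆ ((Finset.univ.filter fun v => σ v = 0) \ E) ∪ A := by
    intro v hv
    obtain ⟨h1, h2⟩ := mem_sweepZeros.1 hv
    rw [Finset.mem_union, Finset.mem_sdiff]
    by_cases hv0 : σ v = 0
    · by_cases hvE : v ∈ E
      · exact Or.inr ((hE v hvE).2.resolve_left h1)
      · exact Or.inl ⟨by simpa using hv0, hvE⟩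
    · obtain ⟨h3, h4⟩ := h2.resolve_left hv0
      exact Or.inr (hA v h1 h3 h4)
  have h2 := (Finset.card_le_card h1).trans (Finset.card_union_le _ _)
  rw [Finset.card_sdiff_of_subset hsub] at h2
  have h3 := Finset.card_le_card hsub
  omega

end Sweep

end WidomRowlinson

/-! ### Strips on the torus and fronts on the grid -/

namespace WidomRowlinson

section Strips

variable {K L M : ℕ}

/-- The vertex of the cycle on `L` vertices that represents an integer. -/
def wrap (hL : 0 < L) (n : ℤ) : Fin L :=
  ⟨(n % L).toNat, by
    have h1 := Int.emod_nonneg n (show (L : ℤ) ≠ 0 by omega)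
    have h2 := Int.emod_lt_of_pos n (show (0 : ℤ) < L by omega)
    omega⟩

theorem wrap_eq_iff (hL : 0 < L) (n : ℤ) (x : Fin L) : wrap hL n = x ↔ (L : ℤ) ∣ n - x := by
  have h1 := Int.emod_nonneg n (show (L : ℤ) ≠ 0 by omega)
  have h2 : ((x : ℕ) : ℤ) % L = x := Int.emod_eq_of_lt (by omega) (by omega)
  rw [Fin.ext_iff, Int.dvd_iff_emod_eq_zero, ← Int.emod_eq_emod_iff_emod_sub_eq_zero, h2]
  show (n % L).toNat = x.val ↔ _
  omega

theorem wrap_val (hL : 0 < L) (x : Fin L) : wrap hL (x.val : ℤ) = x := by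
  rw [wrap_eq_iff, sub_self]
  exact dvd_zero _

theorem wrap_add_self (hL : 0 < L) (n : ℤ) : wrap hL (n + L) = wrap hL n := by
  rw [wrap_eq_iff]
  have h := (wrap_eq_iff hL n _).1 rfl
  rw [show n + L - (wrap hL n : ℤ) = n - (wrap hL n : ℤ) + L by ring]
  exact dvd_add h dvd_rfl

theorem wrap_of_nonneg (hL : 0 < L) {n : ℤ} (h0 : 0 ≤ n) (hn : n < L) :
    ((wrap hL n).val : ℤ) = n := by
  show ((n % L).toNat : ℤ) = n
  rw [Int.emod_eq_of_lt h0 hn]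
  omega

theorem wrap_of_neg (hL : 0 < L) {n : ℤ} (h0 : n < 0) (hn : -L ≤ n) :
    ((wrap hL n).val : ℤ) = n + L := by
  rw [← wrap_add_self]
  exact wrap_of_nonneg hL (by omega) (by omega)

theorem wrap_adj (hL : 2 ≤ L) {n : ℤ} {y : Fin L}
    (h : (SimpleGraph.cycleGraph L).Adj (wrap (by omega) n) y) :
    wrap (by omega) (n + 1) = y ∨ wrap (by omega) (n - 1) = y := by
  rw [cycleGraph_adj_iff_val hL] at h
  have hL0 : 0 < L := by omega
  obtain ⟨k, hk⟩ := (wrap_eq_iff hL0 n _).1 rfl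
  rw [wrap_eq_iff, wrap_eq_iff]
  rcases h with h | h | h | h
  · exact Or.inl ⟨k, by rw [← hk]; omega⟩
  · exact Or.inr ⟨k, by rw [← hk]; omega⟩
  · exact Or.inr ⟨k - 1, by rw [mul_sub, ← hk]; omega⟩
  · exact Or.inl ⟨k + 1, by rw [mul_add, ← hk]; omega⟩

/-- The part of the `K × L` torus that occupies the arc from `p j` to `q j` in row `j`. -/
def strip (hL : 0 < L) (p q : Fin K → ℤ) : Set (Fin K × Fin L) :=
  {v | ∃ n, p v.1 ≤ n ∧ n ≤ q v.1 ∧ wrap hL n = v.2}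

/-- The two sites of each row that bound its arc. -/
def stripEnds (hL : 0 < L) (p q : Fin K → ℤ) : Set (Fin K × Fin L) :=
  {v | wrap hL (p v.1 - 1) = v.2 ∨ wrap hL (q v.1 + 1) = v.2}

/-- For Lipschitz families of arcs the ends of the arcs shield the strip. -/
theorem strip_boundary (hL : 2 ≤ L) {p q : Fin K → ℤ}
    (hp : Lip (SimpleGraph.cycleGraph K) p) (hq : Lip (SimpleGraph.cycleGraph K) q)
    (v w : Fin K × Fin L) (hvw : (lattice K L .periodic).Adj v w)
    (hv : v ∈ strip (by omega) p q) :
    w ∈ strip (by omega) p q ∨ w ∈ stripEnds (by omega) p q := by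
  obtain ⟨n, h1, h2, h3⟩ := hv
  have key : ∀ m, p w.1 - 1 ≤ m → m ≤ q w.1 + 1 → wrap (by omega) m = w.2 →
      w ∈ strip (by omega) p q ∨ w ∈ stripEnds (by omega) p q := by
    intro m hm1 hm2 hm
    rcases hm1.eq_or_lt with h | h
    · exact Or.inr (Or.inl (by rw [h, hm]))
    · rcases hm2.eq_or_lt with h' | h'
      · exact Or.inr (Or.inr (by rw [← h', hm]))
      · exact Or.inl ⟨m, by omega, by omega, hm⟩
  rcases lattice_adj.1 hvw with ⟨hadj, h⟩ | ⟨hadj, h⟩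
  · have h4 := hp _ _ hadj.symm
    have h5 := hq _ _ hadj
    exact key n (by omega) (by omega) (h3.trans h)
  · change (SimpleGraph.cycleGraph L).Adj v.2 w.2 at hadj
    rw [← h3] at hadj
    rw [h] at h1 h2
    rcases wrap_adj hL hadj with h4 | h4
    · exact key _ (by omega) (by omega) h4
    · exact key _ (by omega) (by omega) h4

/-- Sweeping a torus by strips with a fixed Lipschitz upper end `q`. -/
theorem Reach.strip (hL : 2 ≤ L) {σ : Config (lattice K L .periodic) M} {b : Fin (M + 1)}
    (hb : b ≠ 0) {B : ℕ} {p₀ p' q : Fin K → ℤ} (hq : Lip (SimpleGraph.cycleGraph K) q)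
    (h₀ : Lip (SimpleGraph.cycleGraph K) p₀) (h' : Lip (SimpleGraph.cycleGraph K) p')
    (hle : p' ≤ p₀) (hp₀ : ∀ j, q j < p₀ j)
    (hB : ∀ p, p' ≤ p → p ≤ p₀ → (sweepZeros σ.1 b (WidomRowlinson.strip (by omega) p q)
      (stripEnds (by omega) p q)).card + 1 ≤ B) :
    ∃ η : Config (lattice K L .periodic) M, (∀ v, η.1 v = sweepFun σ.1 b
      (WidomRowlinson.strip (by omega) p' q) (stripEnds (by omega) p' q) v) ∧ Reach B σ η := by
  refine Reach.sweep (H := SimpleGraph.cycleGraph K)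
    (S := fun p => WidomRowlinson.strip (by omega) p q)
    (D := fun p => stripEnds (by omega) p q)
    (fun p hp => strip_boundary hL hp hq) ?_ ?_ ?_ hb h₀ h' hle ?_ hB
  · rintro p i v ⟨n, h1, h2, h3⟩
    refine ⟨n, ?_, h2, h3⟩
    by_cases hv : v.1 = i
    · rw [← hv, Function.update_self]
      omega
    · rwa [Function.update_of_ne hv]
  · rintro p i v ⟨n, h1, h2, h3⟩
    by_cases hv : v.1 = i
    · rw [hv, Function.update_self, ← hv] at h1
      rcases h1.eq_or_lt with h | h
      · exact Or.inr (Or.inl (by rw [h, h3]))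
      · exact Or.inl ⟨n, by omega, h2, h3⟩
    · rw [Function.update_of_ne hv] at h1
      exact Or.inl ⟨n, h1, h2, h3⟩
  · intro p i
    refine ⟨(i, wrap (by omega) (p i - 1 - 1)), ?_⟩
    rintro v (hv | hv)
    · by_cases hvi : v.1 = i
      · rw [hvi, Function.update_self] at hv
        exact Or.inr (Prod.ext hvi hv.symm)
      · rw [Function.update_of_ne hvi] at hv
        exact Or.inl (Or.inl hv)
    · exact Or.inl (Or.inr hv)
  · rintro v ⟨n, h1, h2, -⟩
    have := hp₀ v.1
    omega

theorem lip_const {ι : Type*} (H : SimpleGraph ι) (n : ℤ) : Lip H fun _ => n := fun _ _ _ =>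
  Int.le_add_one le_rfl

/-- The sites at the given positions, one in each row. -/
def graphSites (s : Fin K → Fin L) : Finset (Fin K × Fin L) := Finset.univ.image fun j => (j, s j)

theorem card_graphSites_le (s : Fin K → Fin L) : (graphSites s).card ≤ K :=
  Finset.card_image_le.trans_eq (Finset.card_fin K)

theorem mem_graphSites {s : Fin K → Fin L} {v : Fin K × Fin L} :
    v ∈ graphSites s ↔ s v.1 = v.2 := by
  rw [graphSites, Finset.mem_image]
  constructor
  · rintro ⟨j, -, rfl⟩
    rfl
  · intro h
    exact ⟨v.1, Finset.mem_univ _, Prod.ext rfl h⟩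

/-- An arc of length `L` covers the cycle. -/
theorem mem_strip_of_full (hL : 0 < L) {p q : Fin K → ℤ} (v : Fin K × Fin L)
    (h : p v.1 + L ≤ q v.1 + 1) : v ∈ strip hL p q := by
  refine ⟨p v.1 + (v.2 - p v.1) % L, ?_, ?_, ?_⟩
  · have := Int.emod_nonneg (v.2 - p v.1) (show (L : ℤ) ≠ 0 by omega)
    omega
  · have := Int.emod_lt_of_pos (v.2 - p v.1) (show (0 : ℤ) < L by omega)
    omega
  · rw [wrap_eq_iff, Int.emod_def]
    exact ⟨-((v.2 - p v.1) / L), by ring⟩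

/-- On a torus with `K` rows, sweeping column by column turns one pure configuration into another
with at most `2K + 1` empty sites. -/
theorem reach_const_torus (hL : 2 ≤ L) {a b : Fin (M + 1)} (ha : a ≠ 0) (hb : b ≠ 0) :
    Reach (2 * K + 1) (Config.const (lattice K L .periodic) a) (Config.const _ b) := by
  obtain ⟨η, hη, h⟩ := Reach.strip (K := K) hL (σ := Config.const _ a) hb (B := 2 * K + 1)
    (p₀ := fun _ => 1) (p' := fun _ => 1 - L) (q := fun _ => 0) (lip_const _ _) (lip_const _ _)
    (lip_const _ _) (fun j => by show (1 : ℤ) - L ≤ 1; omega) (fun _ => one_pos) (by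
      intro p _ _
      have h1 := card_sweepZeros_add_le (σ := (Config.const (lattice K L .periodic) a).1) (b := b)
        (S := strip (by omega) p fun _ => 0) (D := stripEnds (by omega) p fun _ => 0) (E := ∅)
        (A := graphSites (fun j => wrap (by omega) (p j - 1)) ∪
          graphSites (fun _ => wrap (by omega) (0 + 1)))
        (fun v _ hv _ => by
          rw [Finset.mem_union, mem_graphSites, mem_graphSites]
          exact hv) (fun v hv => absurd hv (Finset.notMem_empty v))
      have h2 := (Finset.card_union_le (graphSites (K := K) fun j => wrap (L := L) (by omega)
        (p j - 1)) (graphSites fun _ => wrap (by omega) (0 + 1))).trans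
        (add_le_add (card_graphSites_le _) (card_graphSites_le _))
      have h3 := empties_const (lattice K L .periodic) ha
      unfold empties at h3
      rw [h3, Finset.card_empty] at h1
      omega)
  refine h.to_const hη fun v => mem_strip_of_full _ v ?_
  omega

/-- On a torus with `K` rows and `E` empty sites, some pure configuration can be reached with at
most `E + 2K - 1` empty sites. Two empty sites are saved when two adjacent columns have empty sites,
and if some column has none, its particles do not have to be removed. -/
theorem exists_reach_const_torus (hK : 2 ≤ K) (hL : 2 ≤ L) (hM : 1 ≤ M)
    (σ : Config (lattice K L .periodic) M) :
    ∃ b, b ≠ 0 ∧ Reach (empties σ + (2 * K - 1)) σ (Config.const _ b) := by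
  have hL0 : 0 < L := by omega
  obtain ⟨q, b, hb, hqb⟩ : ∃ (q : ℤ) (b : Fin (M + 1)), b ≠ 0 ∧
      ((∀ j, σ.1 (j, wrap hL0 (q + 1)) = b) ∨
        ∃ i j, σ.1 (i, wrap hL0 q) = 0 ∧ σ.1 (j, wrap hL0 (q + 1)) = 0) := by
    by_cases hx : ∃ x, ∀ j, σ.1 (j, x) ≠ 0
    · obtain ⟨x, hx⟩ := hx
      refine ⟨x.val - 1, σ.1 (⟨0, by omega⟩, x), hx _, Or.inl fun j => ?_⟩
      rw [sub_add_cancel, wrap_val]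
      refine (σ.separating hK hL).col_eq ?_ (hx _) (hx _)
      have : colZeros σ.1 x = 0 :=
        Finset.card_eq_zero.2 (Finset.filter_eq_empty_iff.2 fun j _ => hx j)
      rw [this]
      exact two_pos
    · push Not at hx
      obtain ⟨m, rfl⟩ := Nat.exists_eq_add_of_le' hM
      obtain ⟨i, hi⟩ := hx (wrap hL0 0)
      obtain ⟨j, hj⟩ := hx (wrap hL0 (0 + 1))
      exact ⟨0, 1, one_ne_zero, Or.inr ⟨i, j, hi, hj⟩⟩
  refine ⟨b, hb, ?_⟩
  obtain ⟨η, hη, h⟩ := Reach.strip (K := K) hL (σ := σ) hb (B := empties σ + (2 * K - 1))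
    (p₀ := fun _ => q + 1) (p' := fun _ => q + 1 - L) (q := fun _ => q) (lip_const _ _)
    (lip_const _ _) (lip_const _ _) (fun j => by show q + 1 - (L : ℤ) ≤ q + 1; omega)
    (fun _ => by omega) (by
      intro p _ hp
      have hcard := card_graphSites_le (K := K) fun j => wrap hL0 (p j - 1)
      have hcard' := card_graphSites_le (K := K) fun _ => wrap hL0 (q + 1)
      rcases hqb with hqb | ⟨i, j, hi, hj⟩
      · have h1 := card_sweepZeros_add_le (σ := σ.1) (b := b)
          (S := strip hL0 p fun _ => q) (D := stripEnds hL0 p fun _ => q) (E := ∅)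
          (A := graphSites (fun j => wrap hL0 (p j - 1)))
          (fun v _ hv hvb => by
            rw [mem_graphSites]
            refine hv.resolve_right fun h => hvb ?_
            have := hqb v.1
            rwa [h] at this) (fun v hv => absurd hv (Finset.notMem_empty v))
        rw [Finset.card_empty] at h1
        unfold empties
        omega
      · have hne : wrap hL0 q ≠ wrap hL0 (q + 1) := by
          intro heq
          obtain ⟨k, hk⟩ := (wrap_eq_iff hL0 _ _).1 heq
          obtain ⟨l, hl⟩ := (wrap_eq_iff hL0 (q + 1) _).1 rfl
          have : (L : ℤ) ∣ 1 := ⟨l - k, by rw [mul_sub, ← hk, ← hl]; ring⟩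
          have := Int.le_of_dvd one_pos this
          omega
        have h1 := card_sweepZeros_add_le (σ := σ.1) (b := b)
          (S := strip hL0 p fun _ => q) (D := stripEnds hL0 p fun _ => q)
          (E := {(i, wrap hL0 q), (j, wrap hL0 (q + 1))})
          (A := graphSites (fun j => wrap hL0 (p j - 1)) ∪ graphSites (fun _ => wrap hL0 (q + 1)))
          (fun v _ hv _ => by
            rw [Finset.mem_union, mem_graphSites, mem_graphSites]
            exact hv) (fun v hv => by
            rw [Finset.mem_insert, Finset.mem_singleton] at hv
            rw [Finset.mem_union, mem_graphSites, mem_graphSites]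
            rcases hv with rfl | rfl
            · refine ⟨hi, ?_⟩
              have h1 : p i ≤ q + 1 := hp i
              rcases h1.eq_or_lt with h | h
              · refine Or.inr (Or.inl ?_)
                show wrap hL0 (p i - 1) = wrap hL0 q
                rw [h, add_sub_cancel_right]
              · exact Or.inl ⟨q, by show p i ≤ q; omega, le_rfl, rfl⟩
            · exact ⟨hj, Or.inr (Or.inr rfl)⟩)
        have h2 := (Finset.card_union_le (graphSites (K := K) fun j => wrap hL0 (p j - 1))
          (graphSites fun _ => wrap hL0 (q + 1))).trans (add_le_add hcard hcard')
        rw [Finset.card_pair fun h => hne (congrArg Prod.snd h)] at h1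
        unfold empties
        omega)
  refine h.to_const hη fun v => mem_strip_of_full _ v ?_
  omega

/-- The distance of a vertex of a cycle to the vertex `0`. -/
def cycDist (x : Fin K) : ℤ := min (x.val : ℤ) (K - x.val)

theorem lip_cycDist (hK : 2 ≤ K) : Lip (SimpleGraph.cycleGraph K) cycDist := by
  intro i j h
  rw [cycleGraph_adj_iff_val hK] at h
  unfold cycDist
  omega

/-- The configuration on a square torus in which the two diagonals through the origin are empty
and separate a region of type `b` from a region of type `a`. -/
def crossFun (a b : Fin (M + 1)) (v : Fin K × Fin K) : Fin (M + 1) :=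
  if cycDist v.2 < cycDist v.1 then b else if cycDist v.2 = cycDist v.1 then 0 else a

theorem exists_reach_cross (hK : 2 ≤ K) {a b : Fin (M + 1)} (ha : a ≠ 0) (hb : b ≠ 0)
    (hab : a ≠ b) :
    ∃ η : Config (lattice K K .periodic) M, (∀ v, η.1 v = crossFun a b v) ∧
      Reach (2 * K) (Config.const _ a) η := by
  have hK0 : 0 < K := by omega
  have hδ : ∀ j : Fin K, 0 ≤ cycDist j ∧ 2 * cycDist j ≤ K := fun j => by
    unfold cycDist
    omega
  have hlip := lip_cycDist hK
  obtain ⟨η, hη, h⟩ := Reach.strip (K := K) hK (σ := Config.const _ a) hb (B := 2 * K)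
    (p₀ := fun j => cycDist j + 1) (p' := fun j => 1 - cycDist j) (q := fun j => cycDist j - 1)
    (fun i j h => by have := hlip i j h; beta_reduce; omega)
    (fun i j h => by have := hlip i j h; beta_reduce; omega)
    (fun i j h => by have := hlip j i h.symm; beta_reduce; omega)
    (fun j => by
      have := hδ j
      show 1 - cycDist j ≤ cycDist j + 1
      omega)
    (fun j => by omega) (by
      intro p hp hp'
      -- in row `0` the arc stays empty and both of its ends are the vertex `0`
      have h0 : p ⟨0, hK0⟩ - 1 = cycDist (⟨0, hK0⟩ : Fin K) - 1 + 1 := by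
        have h1 : 1 - cycDist (⟨0, hK0⟩ : Fin K) ≤ _ := hp ⟨0, hK0⟩
        have h2 : _ ≤ cycDist (⟨0, hK0⟩ : Fin K) + 1 := hp' ⟨0, hK0⟩
        have h3 : cycDist (⟨0, hK0⟩ : Fin K) = 0 := by
          simp [cycDist]
        omega
      have h1 := card_sweepZeros_add_le (σ := (Config.const (lattice K K .periodic) a).1) (b := b)
        (S := strip hK0 p fun j => cycDist j - 1) (D := stripEnds hK0 p fun j => cycDist j - 1)
        (E := ∅) (A := graphSites (fun j => wrap hK0 (p j - 1)) ∪
          (graphSites (fun j => wrap hK0 (cycDist j - 1 + 1))).erase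
            (⟨0, hK0⟩, wrap hK0 (cycDist (⟨0, hK0⟩ : Fin K) - 1 + 1)))
        (fun v _ hv _ => by
          rw [Finset.mem_union, Finset.mem_erase, mem_graphSites, mem_graphSites]
          by_cases hv0 : v = (⟨0, hK0⟩, wrap hK0 (cycDist (⟨0, hK0⟩ : Fin K) - 1 + 1))
          · left
            rw [hv0, h0]
          · exact hv.imp_right fun h => ⟨hv0, h⟩)
        (fun v hv => absurd hv (Finset.notMem_empty v))
      have h2 := Finset.card_union_le (graphSites (K := K) fun j => wrap hK0 (p j - 1))
          ((graphSites (fun j => wrap hK0 (cycDist j - 1 + 1))).erase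
            (⟨0, hK0⟩, wrap hK0 (cycDist (⟨0, hK0⟩ : Fin K) - 1 + 1)))
      rw [Finset.card_erase_of_mem (mem_graphSites.2 rfl)] at h2
      have h4 := card_graphSites_le (K := K) fun j => wrap hK0 (p j - 1)
      have h5 := card_graphSites_le (K := K) fun j => wrap hK0 (cycDist j - 1 + 1)
      have h3 := empties_const (lattice K K .periodic) ha
      unfold empties at h3
      rw [h3, Finset.card_empty] at h1
      omega)
  refine ⟨η, fun v => ?_, h⟩
  rw [hη v]
  have hd := hδ v.1
  have hS : v ∈ strip hK0 (fun j => 1 - cycDist j) (fun j => cycDist j - 1) ↔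
      cycDist v.2 < cycDist v.1 := by
    constructor
    · rintro ⟨n, h1, h2, h3⟩
      simp only at h1 h2
      rcases lt_or_ge n 0 with hn | hn
      · have := wrap_of_neg hK0 hn (by omega)
        rw [h3] at this
        unfold cycDist at *
        omega
      · have := wrap_of_nonneg hK0 hn (by omega)
        rw [h3] at this
        unfold cycDist at *
        omega
    · intro h
      rcases le_total (v.2.val : ℤ) (K - v.2.val) with h1 | h1
      · have h2 : cycDist v.2 = v.2.val := min_eq_left h1
        exact ⟨v.2.val, by beta_reduce; omega, by beta_reduce; omega, wrap_val hK0 v.2⟩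
      · have h2 : cycDist v.2 = K - v.2.val := min_eq_right h1
        refine ⟨v.2.val - K, by beta_reduce; omega, by beta_reduce; omega, ?_⟩
        rw [← wrap_add_self, sub_add_cancel, wrap_val]
  have hD : v ∈ stripEnds hK0 (fun j => 1 - cycDist j) (fun j => cycDist j - 1) ↔
      cycDist v.2 = cycDist v.1 := by
    have e1 : 1 - cycDist v.1 - 1 = -cycDist v.1 := by omega
    have e2 : cycDist v.1 - 1 + 1 = cycDist v.1 := by omega
    have hpos := wrap_of_nonneg hK0 hd.1 (by omega)
    show wrap hK0 (1 - cycDist v.1 - 1) = v.2 ∨ wrap hK0 (cycDist v.1 - 1 + 1) = v.2 ↔ _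
    rw [e1, e2]
    constructor
    · rintro (h1 | h1)
      · rcases hd.1.eq_or_lt with h2 | h2
        · have := wrap_of_nonneg hK0 (n := -cycDist v.1) (by omega) (by omega)
          rw [h1] at this
          unfold cycDist at *
          omega
        · have := wrap_of_neg hK0 (n := -cycDist v.1) (by omega) (by omega)
          rw [h1] at this
          unfold cycDist at *
          omega
      · rw [h1] at hpos
        unfold cycDist at *
        omega
    · intro h
      rw [← h]
      rcases le_total (v.2.val : ℤ) (K - v.2.val) with h1 | h1
      · right
        rw [show cycDist v.2 = v.2.val from min_eq_left h1, wrap_val]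
      · left
        rw [show cycDist v.2 = K - v.2.val from min_eq_right h1, ← wrap_add_self,
          show -((K : ℤ) - v.2.val) + K = v.2.val by ring, wrap_val]
  unfold sweepFun crossFun
  by_cases h1 : cycDist v.2 < cycDist v.1
  · rw [if_pos (hS.2 h1), if_pos h1]
  · rw [if_neg (fun h => h1 (hS.1 h)), if_neg h1]
    by_cases h2 : cycDist v.2 = cycDist v.1
    · rw [if_pos ⟨hD.2 h2, hab⟩, if_pos h2]
    · rw [if_neg (fun h => h2 (hD.1 h.1)), if_neg h2]
      rfl

/-- On a square torus two pure configurations are joined with at most `2K` empty sites: both reach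
the same cross-shaped configuration, since transposition exchanges its two regions. -/
theorem reach_const_square_torus (hK : 2 ≤ K) {a b : Fin (M + 1)} (ha : a ≠ 0) (hb : b ≠ 0)
    (hab : a ≠ b) :
    Reach (2 * K) (Config.const (lattice K K .periodic) a) (Config.const _ b) := by
  obtain ⟨η, hη, h⟩ := exists_reach_cross hK ha hb hab
  obtain ⟨ζ, hζ, h'⟩ := exists_reach_cross hK hb ha hab.symm
  have h2 := h'.comap (latticeSwap K K .periodic)
  have : ζ.comap (latticeSwap K K .periodic) = η := by
    apply Subtype.ext
    funext v
    rw [hη]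
    show ζ.1 (v.2, v.1) = _
    rw [hζ]
    unfold crossFun
    simp only
    split_ifs <;> first | rfl | omega
  rw [this] at h2
  exact h.trans h2.symm

/-- Sweeping a grid of paths from the right, with front `p`. -/
theorem Reach.front (hL : 0 < L) {σ : Config (lattice K L .free) M} {b : Fin (M + 1)}
    (hb : b ≠ 0) {B : ℕ} {n : ℤ} (hn : 0 ≤ n) (hσ : ∀ v : Fin K × Fin L, n ≤ v.2.val → σ.1 v = b)
    (hB : ∀ p : Fin K → ℤ, (∀ j, p j ≤ n) →
      (sweepZeros σ.1 b {v | p v.1 ≤ v.2.val} {v | (v.2.val : ℤ) = p v.1 - 1}).card + 1 ≤ B) :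
    Reach B σ (Config.const _ b) := by
  obtain ⟨η, hη, h⟩ := Reach.sweep (H := SimpleGraph.pathGraph K) (G := lattice K L .free)
    (S := fun p => {v | p v.1 ≤ v.2.val}) (D := fun p => {v | (v.2.val : ℤ) = p v.1 - 1})
    (σ := σ) (B := B) (p₀ := fun _ => n) (p' := fun _ => 0)
    (fun p hp v w hvw hv => by
      change p v.1 ≤ v.2.val at hv
      show p w.1 ≤ w.2.val ∨ (w.2.val : ℤ) = p w.1 - 1
      rcases lattice_adj.1 hvw with ⟨hadj, h⟩ | ⟨hadj, h⟩
      · have := hp _ _ hadj.symm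
        rw [← h]
        omega
      · have := SimpleGraph.pathGraph_adj.1 hadj
        rw [← h]
        omega)
    (fun p i v hv => by
      change p v.1 ≤ v.2.val at hv
      show Function.update p i (p i - 1) v.1 ≤ v.2.val
      by_cases hvi : v.1 = i
      · rw [hvi] at hv
        rw [hvi, Function.update_self]
        omega
      · rwa [Function.update_of_ne hvi])
    (fun p i v hv => by
      change Function.update p i (p i - 1) v.1 ≤ v.2.val at hv
      show p v.1 ≤ v.2.val ∨ (v.2.val : ℤ) = p v.1 - 1
      by_cases hvi : v.1 = i
      · rw [hvi, Function.update_self] at hv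
        rw [hvi]
        omega
      · rw [Function.update_of_ne hvi] at hv
        exact Or.inl hv)
    (fun p i => by
      by_cases hx : ∃ x : Fin L, (x.val : ℤ) = p i - 1 - 1
      · obtain ⟨x, hx⟩ := hx
        refine ⟨(i, x), fun v hv => ?_⟩
        change (v.2.val : ℤ) = Function.update p i (p i - 1) v.1 - 1 at hv
        by_cases hvi : v.1 = i
        · rw [hvi, Function.update_self] at hv
          exact Or.inr (Prod.ext hvi (Fin.ext (show v.2.val = x.val by omega)))
        · rw [Function.update_of_ne hvi] at hv
          exact Or.inl hv
      · refine ⟨(i, ⟨0, hL⟩), fun v hv => ?_⟩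
        change (v.2.val : ℤ) = Function.update p i (p i - 1) v.1 - 1 at hv
        by_cases hvi : v.1 = i
        · rw [hvi, Function.update_self] at hv
          exact absurd ⟨v.2, hv⟩ hx
        · rw [Function.update_of_ne hvi] at hv
          exact Or.inl hv)
    hb (lip_const _ _) (lip_const _ _) (fun _ => hn) hσ (fun p _ hp => hB p hp)
  exact h.to_const hη fun v => by
    show (0 : ℤ) ≤ v.2.val
    omega

theorem card_front_le (p : Fin K → ℤ) :
    (Finset.univ.filter fun v : Fin K × Fin L => (v.2.val : ℤ) = p v.1 - 1).card ≤ K := by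
  refine (Finset.card_le_card_of_injOn Prod.fst (fun v _ => Finset.mem_coe.2 (Finset.mem_univ _))
    fun v hv w hw h => Prod.ext h (Fin.ext ?_)).trans_eq (Finset.card_fin K)
  have hv' : (v.2.val : ℤ) = p v.1 - 1 := by simpa using hv
  have hw' : (w.2.val : ℤ) = p w.1 - 1 := by simpa using hw
  rw [h] at hv'
  omega

/-- On a grid of paths with `K` rows, sweeping column by column turns one pure configuration into
another with at most `K + 1` empty sites. -/
theorem reach_const_grid (hL : 0 < L) {a b : Fin (M + 1)} (ha : a ≠ 0) (hb : b ≠ 0) :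
    Reach (K + 1) (Config.const (lattice K L .free) a) (Config.const _ b) := by
  refine Reach.front hL hb (n := L) (by omega) (fun v hv => by omega) fun p _ => ?_
  have h1 := card_sweepZeros_add_le (σ := (Config.const (lattice K L .free) a).1) (b := b)
    (S := {v | p v.1 ≤ v.2.val}) (D := {v | (v.2.val : ℤ) = p v.1 - 1}) (E := ∅)
    (A := Finset.univ.filter fun v => (v.2.val : ℤ) = p v.1 - 1)
    (fun v _ hv _ => Finset.mem_filter.2 ⟨Finset.mem_univ _, hv⟩)
    (fun v hv => absurd hv (Finset.notMem_empty v))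
  have h2 := card_front_le (L := L) p
  have h3 := empties_const (lattice K L .free) ha
  unfold empties at h3
  rw [h3, Finset.card_empty] at h1
  omega

/-- On a grid of paths with `K` rows and `E > 0` empty sites, some pure configuration can be reached
with at most `E + K` empty sites: the columns to the right of the last one with an empty site are
of a single type, with which the remaining ones are swept. -/
theorem exists_reach_const_grid (hK : 2 ≤ K) (hL : 2 ≤ L) (hM : 1 ≤ M)
    (σ : Config (lattice K L .free) M) (hσ : empties σ ≠ 0) :
    ∃ b, b ≠ 0 ∧ Reach (empties σ + K) σ (Config.const _ b) := by
  obtain ⟨z, hz, hmax⟩ := Finset.exists_max_image (Finset.univ.filter fun v => σ.1 v = 0)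
    (fun v => v.2.val) (Finset.card_ne_zero.1 hσ)
  have hz0 : σ.1 z = 0 := (Finset.mem_filter.1 hz).2
  have hne : ∀ v : Fin K × Fin L, z.2 < v.2 → σ.1 v ≠ 0 := fun v hv h0 =>
    absurd (hmax v (by simpa using h0)) (not_le.2 hv)
  obtain ⟨b, hb, hzb⟩ : ∃ b : Fin (M + 1), b ≠ 0 ∧ ∀ v : Fin K × Fin L, z.2 < v.2 → σ.1 v = b := by
    by_cases hx : ∃ x, z.2 < x
    · obtain ⟨x, hx⟩ := hx
      have hrow : ∀ j (x y : Fin L), z.2 < x → x < y → σ.1 (j, x) = σ.1 (j, y) := by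
        intro j x y hx hxy
        by_contra hc
        obtain ⟨w, hw, -, hw0⟩ := exists_zero_between (g := fun x => σ.1 (j, x))
          (fun x y h => σ.2 _ _ (lattice_adj.2 (Or.inr ⟨SimpleGraph.pathGraph_adj.2 (Or.inl h),
            rfl⟩))) hxy (hne _ hx) (hne _ (hx.trans hxy)) hc
        exact hne (j, w) (hx.trans hw) hw0
      refine ⟨σ.1 (⟨0, by omega⟩, x), hne _ hx, fun v hv => ?_⟩
      have h1 : σ.1 v = σ.1 (v.1, x) := by
        rcases lt_trichotomy v.2 x with h | h | h
        · exact hrow v.1 _ _ hv h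
        · rw [← h]
        · exact (hrow v.1 _ _ hx h).symm
      rw [h1]
      refine (σ.separating hK hL).col_eq ?_ (hne _ hx) (hne _ hx)
      have : colZeros σ.1 x = 0 :=
        Finset.card_eq_zero.2 (Finset.filter_eq_empty_iff.2 fun j _ => hne (j, x) hx)
      rw [this]
      exact one_pos
    · obtain ⟨m, rfl⟩ := Nat.exists_eq_add_of_le' hM
      exact ⟨1, one_ne_zero, fun v hv => absurd ⟨v.2, hv⟩ hx⟩
  refine ⟨b, hb, Reach.front (by omega) hb (n := z.2.val + 1) (by omega)
    (fun v hv => hzb v (Fin.lt_def.2 (by omega))) fun p hp => ?_⟩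
  have h1 := card_sweepZeros_add_le (σ := σ.1) (b := b)
    (S := {v | p v.1 ≤ v.2.val}) (D := {v | (v.2.val : ℤ) = p v.1 - 1}) (E := {z})
    (A := Finset.univ.filter fun v => (v.2.val : ℤ) = p v.1 - 1)
    (fun v _ hv _ => Finset.mem_filter.2 ⟨Finset.mem_univ _, hv⟩)
    (fun v hv => by
      rw [Finset.mem_singleton] at hv
      subst hv
      refine ⟨hz0, ?_⟩
      rw [Finset.mem_filter]
      rcases (hp v.1).eq_or_lt with h | h
      · exact Or.inr ⟨Finset.mem_univ _, by omega⟩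
      · exact Or.inl (by show p v.1 ≤ v.2.val; omega))
  have h2 := card_front_le (L := L) p
  rw [Finset.card_singleton] at h1
  unfold empties
  omega

end Strips

end WidomRowlinson

/-! ### The barrier -/

namespace WidomRowlinson

section Barrier

variable {K L M : ℕ}

theorem reach_barrier (hK : 2 ≤ K) (hL : 2 ≤ L) {bc : Boundary} {a b : Fin (M + 1)} (ha : a ≠ 0)
    (hb : b ≠ 0) (hab : a ≠ b) :
    Reach (barrier K L bc) (Config.const (lattice K L bc) a) (Config.const _ b) := by
  wlog hKL : K ≤ L generalizing K L
  · rw [barrier_comm]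
    exact (this hL hK (by omega)).comap (latticeSwap K L bc)
  cases bc with
  | free => exact (reach_const_grid (by omega) ha hb).mono (by show K + 1 ≤ min K L + 1; omega)
  | periodic =>
    rcases hKL.eq_or_lt with rfl | hlt
    · exact (reach_const_square_torus hK ha hb hab).mono (if_pos rfl).ge
    · refine (reach_const_torus hL ha hb).mono ?_
      show _ ≤ if K = L then 2 * K else min (2 * K) (2 * L) + 1
      rw [if_neg (by omega)]
      omega

theorem exists_reach_const (hK : 2 ≤ K) (hL : 2 ≤ L) (hM : 1 ≤ M) {bc : Boundary}
    (σ : Config (lattice K L bc) M) (hσ : empties σ ≠ 0) :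
    ∃ b, b ≠ 0 ∧ Reach (empties σ + (barrier K L bc - 1)) σ (Config.const _ b) := by
  wlog hKL : K ≤ L generalizing K L
  · obtain ⟨b, hb, h⟩ := this hL hK (σ.comap (latticeSwap L K bc))
      (by rwa [empties_comap]) (by omega)
    rw [empties_comap] at h
    rw [barrier_comm]
    exact ⟨b, hb, h.comap (latticeSwap K L bc)⟩
  cases bc with
  | free =>
    obtain ⟨b, hb, h⟩ := exists_reach_const_grid hK hL hM σ hσ
    refine ⟨b, hb, h.mono ?_⟩
    show _ ≤ _ + (min K L + 1 - 1)
    omega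
  | periodic =>
    obtain ⟨b, hb, h⟩ := exists_reach_const_torus hK hL hM σ
    refine ⟨b, hb, h.mono ?_⟩
    show _ ≤ _ + ((if K = L then 2 * K else min (2 * K) (2 * L) + 1) - 1)
    split_ifs <;> omega

theorem barrier_pos (hK : 2 ≤ K) (bc : Boundary) : 0 < barrier K L bc := by
  cases bc with
  | free => exact Nat.succ_pos _
  | periodic =>
    show 0 < if K = L then 2 * K else min (2 * K) (2 * L) + 1
    split_ifs <;> omega

end Barrier

end WidomRowlinson

theorem theorem3p1 (K L M : ℕ) (hK : 2 ≤ K) (hL : 2 ≤ L) (hM : 2 ≤ M)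
    (bc : WidomRowlinson.Boundary)
    (hbc : bc = WidomRowlinson.Boundary.periodic → 6 ≤ K + L) :
    (∀ s ∈ WidomRowlinson.stable (WidomRowlinson.lattice K L bc) M,
      ∀ s' ∈ WidomRowlinson.stable (WidomRowlinson.lattice K L bc) M, s ≠ s' →
        WidomRowlinson.commHeight s s' - WidomRowlinson.energy s
          = (WidomRowlinson.barrier K L bc : ℝ)) ∧
    (∀ σ : WidomRowlinson.Config (WidomRowlinson.lattice K L bc) M,
      σ ∉ WidomRowlinson.stable (WidomRowlinson.lattice K L bc) M →
        WidomRowlinson.setCommHeight {σ} (WidomRowlinson.stable (WidomRowlinson.lattice K L bc) M)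
          - WidomRowlinson.energy σ < (WidomRowlinson.barrier K L bc : ℝ)) := by
  have hM1 : 1 ≤ M := by omega
  have hpos := WidomRowlinson.barrier_pos (L := L) hK bc
  refine ⟨fun s hs s' hs' hne => ?_, fun σ hσ => ?_⟩
  · rw [WidomRowlinson.mem_stable_iff hM1] at hs hs'
    have he := WidomRowlinson.energy_eq_empties_sub_card s
    obtain ⟨a, ha, rfl⟩ := WidomRowlinson.eq_const_of_empties_eq_zero hK hL hs
    obtain ⟨b, hb, rfl⟩ := WidomRowlinson.eq_const_of_empties_eq_zero hK hL hs'
    have hab : a ≠ b := fun h => hne (by rw [h])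
    have h1 := WidomRowlinson.commHeight_le_of_reach hM1
      (by rw [hs]; exact Nat.zero_le _) (WidomRowlinson.reach_barrier (bc := bc) hK hL ha hb hab)
    have h2 : (WidomRowlinson.barrier K L bc : ℝ) - Fintype.card (Fin K × Fin L) ≤
        WidomRowlinson.commHeight (WidomRowlinson.Config.const (WidomRowlinson.lattice K L bc) a)
          (WidomRowlinson.Config.const _ b) := by
      by_contra hlt
      have h3 : ((WidomRowlinson.barrier K L bc - 1 : ℕ) : ℝ) + 1 =
          WidomRowlinson.barrier K L bc := by
        exact_mod_cast Nat.sub_add_cancel hpos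
      have h4 := WidomRowlinson.barrier_le_of_reach hK hL hbc ha hb hab
        (WidomRowlinson.reach_of_commHeight_lt hM1 (B := WidomRowlinson.barrier K L bc - 1)
          (by rw [h3]; exact not_le.1 hlt))
      omega
    rw [he, hs]
    push_cast at h1 h2 ⊢
    linarith
  · rw [WidomRowlinson.mem_stable_iff hM1] at hσ
    obtain ⟨b, hb, h⟩ := WidomRowlinson.exists_reach_const hK hL hM1 σ hσ
    have h1 := WidomRowlinson.commHeight_le_of_reach hM1 (Nat.le_add_right _ _) h
    have h2 : WidomRowlinson.setCommHeight {σ}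
        (WidomRowlinson.stable (WidomRowlinson.lattice K L bc) M) ≤
          WidomRowlinson.commHeight σ (WidomRowlinson.Config.const _ b) :=
      (WidomRowlinson.isLeast_setCommHeight (Set.singleton_nonempty σ)
        WidomRowlinson.stable_nonempty).2 ⟨σ, rfl, _, (WidomRowlinson.mem_stable_iff hM1).2
          (WidomRowlinson.empties_const _ hb), rfl⟩
    have h3 : ((WidomRowlinson.barrier K L bc - 1 : ℕ) : ℝ) + 1 =
        WidomRowlinson.barrier K L bc := by
      exact_mod_cast Nat.sub_add_cancel hpos
    rw [WidomRowlinson.energy_eq_empties_sub_card]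
    push_cast at h1
    linarith
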